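/- Let $n\ge 0$, let $V=\{x_1,\dots,x_n\}$ be propositional variables and let $\pi\in S_n$ be an order on them ($\pi(i)$ is the position of $x_i$). Write $x_i^1$ for $x_i$ and $x_i^0$ for $\bar x_i$. A clause is a set of literals in which no variable appears together with its negation, and a CNF is a set of clauses. The resolution rule derives the clause $C\lor D$ from clauses $C\lor x_i^a$ and $D\lor x_i^{1-a}$ $(a\in\{0,1\})$, where $x_i$ occurs neither in $C$ nor in $D$. In $\pi$-ordered resolution the rule may be applied only if every literal of $C\lor D$ has a variable $x_j$ with $\pi(j)<\pi(i)$; in $\pi$-half-ordered resolution it may be applied only if this holds for all literals of $C$ or for all literals of $D$. There is no weakening rule. A refutation of a CNF $\tau$ is a sequence of lines in which the empty clause occurs; each line is a clause that is either marked as an axiom and belongs to $\tau$, or is obtained by the (restricted) rule from two specified earlier lines. Its size $|\Pi|$ is its number of lines. A system $P$ p-simulates a system $Q$ if there is a single algorithm, for all $n$ and $\pi$, that takes $\pi$ and any $Q$-refutation $\Pi$ with respect to $\pi$, runs in time polynomial in the length of this input, and outputs a $P$-refutation $\Pi'$ with respect to $\pi$, such that $\Pi'$ refutes every CNF $\tau$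 that $\Pi$ refutes (it uses no other axioms) and $|\Pi'|$ is bounded by a polynomial in $|\Pi|$. Two systems are polynomially equivalent if they p-simulate each other. **Theorem 2.1.** $\pi$-ordered resolution and $\pi$-half-ordered resolution are polynomially equivalent, uniformly in $n$ and in the order $\pi\in S_n$. Moreover, the p-simulation of $\pi$-half-ordered by $\pi$-ordered resolution can be chosen such that, for all $n\ge 1$, it takes every $\pi$-half-ordered refutation $\Pi$ to a $\pi$-ordered refutation $\Pi'$ with $|\Pi'|\le n\,|\Pi|$. -/

import Mathlib

/-! Clauses and resolution over the variables `x_i`, `i : Fin n`. -/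

namespace OrdRes

/-- The literal `x_i^a`: `(i, true)` is the variable `x_i`, `(i, false)` is its negation. -/
abbrev Lit (n : ℕ) : Type := Fin n × Bool

/-- A clause: a set of literals in which no variable occurs together with its negation. -/
@[ext]
structure Clause (n : ℕ) where
  lits : Finset (Lit n)
  consistent : ∀ i : Fin n, ¬ ((i, true) ∈ lits ∧ (i, false) ∈ lits)

/-- How a line of a proof is justified: it is an axiom, or it is obtained by the resolution rule
from the lines number `j` and `k` (lines are numbered from `0`). -/
inductive Just : Type
  | ax : Just
  | res (j k : ℕ) : Just

/-- A line of a proof: a clause together with its justification. -/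
structure Line (n : ℕ) where
  clause : Clause n
  just : Just

/-- A (candidate) resolution proof is a sequence of lines; its size is its length. -/
abbrev Proof (n : ℕ) : Type := List (Line n)

/-- A subsystem of resolution, uniform in the number `n` of variables and in the order `π`
(`π i` is the position of the variable `x_i`): it tells which instances
`C ∨ x_i^a, D ∨ x_i^(1-a) ⊢ C ∨ D` of the resolution rule are allowed.
The arguments are `n`, `π`, `i`, `C`, `D`. -/
abbrev System : Type :=
  (n : ℕ) → Equiv.Perm (Fin n) → Fin n → Finset (Lit n) → Finset (Lit n) → Prop

/-- `π`-ordered resolution: all variables of `C ∨ D` are smaller than the resolved one. -/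
def ordered : System := fun _ π i C D => ∀ l ∈ C ∪ D, π l.1 < π i

/-- `π`-half-ordered resolution: in at least one of the two antecedents
all other variables are smaller than the resolved one. -/
def halfOrdered : System := fun _ π i C D =>
  (∀ l ∈ C, π l.1 < π i) ∨ (∀ l ∈ D, π l.1 < π i)

/-- `G` follows from `E = C ∨ x_i^a` and `F = D ∨ x_i^(1-a)` by an allowed instance of the
resolution rule, where `C` and `D` are `E` and `F` without the resolved literals.
Note that `G`, being a clause, is not a tautology. -/
def Infers (S : System) {n : ℕ} (π : Equiv.Perm (Fin n)) (E F G : Clause n) : Prop :=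
  ∃ (i : Fin n) (a : Bool), (i, a) ∈ E.lits ∧ (i, !a) ∈ F.lits ∧
    S n π i (E.lits.erase (i, a)) (F.lits.erase (i, !a)) ∧
    G.lits = E.lits.erase (i, a) ∪ F.lits.erase (i, !a)

/-- The line `L`, at place `t` of the sequence `P`, is correctly justified with axioms from `τ`. -/
def LineOK (S : System) {n : ℕ} (π : Equiv.Perm (Fin n)) (τ : Set (Clause n))
    (P : Proof n) (t : ℕ) (L : Line n) : Prop :=
  match L.just with
  | Just.ax => L.clause ∈ τ
  | Just.res j k => j < t ∧ k < t ∧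
      ∃ A B : Line n, P[j]? = some A ∧ P[k]? = some B ∧ Infers S π A.clause B.clause L.clause

/-- `P` is a proof in the system `S`, with respect to the order `π`, from the CNF `τ`. -/
def IsProof (S : System) {n : ℕ} (π : Equiv.Perm (Fin n)) (τ : Set (Clause n))
    (P : Proof n) : Prop :=
  ∀ (t : ℕ) (L : Line n), P[t]? = some L → LineOK S π τ P t L

/-- `P` is a refutation of `τ`: a proof from `τ` in which the empty clause occurs. -/
def Refutes (S : System) {n : ℕ} (π : Equiv.Perm (Fin n)) (τ : Set (Clause n))
    (P : Proof n) : Prop :=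
  IsProof S π τ P ∧ ∃ L ∈ P, L.clause.lits = ∅

/-! Algorithms: while programs over binary trees (S-expressions), with a running time.

Every instruction that reads or builds a value is charged the size of that value, written
out as a tree without sharing. So every value that occurs in a computation has size at most the
size of the input plus the running time, and the functions computable in polynomial time are
the same as for Turing machines. -/

/-- Data values: binary trees. -/
inductive Data : Type
  | nil : Data
  | cons (a b : Data) : Data

namespace Data

def size : Data → ℕ
  | nil => 1
  | cons a b => a.size + b.size + 1

def head : Data → Data
  | nil => nil
  | cons a _ => a

def tail : Data → Data
  | nil => nil
  | cons _ b => b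

end Data

/-- Programs; each one computes a partial function from data to data. -/
inductive Prog : Type
  | id : Prog
  | nil : Prog
  | head : Prog
  | tail : Prog
  /-- `v ↦ cons (f v) (g v)` -/
  | cons (f g : Prog) : Prog
  /-- First `f`, then `g`. -/
  | seq (f g : Prog) : Prog
  /-- `v ↦ f v` if `c v ≠ nil`, and `v ↦ g v` if `c v = nil`. -/
  | ite (c f g : Prog) : Prog
  /-- As long as `c v ≠ nil`, replace `v` by `f v`; return `v`. -/
  | loop (c f : Prog) : Prog

/-- `Run p v w t`: on input `v`, the program `p` halts with output `w`, in time `t`. -/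
inductive Run : Prog → Data → Data → ℕ → Prop
  | id (v : Data) : Run Prog.id v v v.size
  | nil (v : Data) : Run Prog.nil v Data.nil 1
  | head (v : Data) : Run Prog.head v v.head v.size
  | tail (v : Data) : Run Prog.tail v v.tail v.size
  | cons {f g : Prog} {v a b : Data} {s t : ℕ} (hf : Run f v a s) (hg : Run g v b t) :
      Run (Prog.cons f g) v (Data.cons a b) (s + t + (Data.cons a b).size)
  | seq {f g : Prog} {v u w : Data} {s t : ℕ} (hf : Run f v u s) (hg : Run g u w t) :
      Run (Prog.seq f g) v w (s + t + 1)
  | ite_true {c f g : Prog} {v b w : Data} {s t : ℕ} (hc : Run c v b s) (hb : b ≠ Data.nil)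
      (hf : Run f v w t) : Run (Prog.ite c f g) v w (s + t + 1)
  | ite_false {c f g : Prog} {v w : Data} {s t : ℕ} (hc : Run c v Data.nil s)
      (hg : Run g v w t) : Run (Prog.ite c f g) v w (s + t + 1)
  | loop_done {c f : Prog} {v : Data} {s : ℕ} (hc : Run c v Data.nil s) :
      Run (Prog.loop c f) v v (s + 1)
  | loop_step {c f : Prog} {v b u w : Data} {r s t : ℕ} (hc : Run c v b r) (hb : b ≠ Data.nil)
      (hf : Run f v u s) (hl : Run (Prog.loop c f) u w t) :
      Run (Prog.loop c f) v w (r + s + t + 1)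

/-! Encoding of orders and proofs as data. Natural numbers are written in unary: those that
occur are variables (smaller than `n`, while the order alone takes more than `n` symbols) and line
numbers (smaller than the number of lines), so this is as concise as binary, up to a polynomial. -/

def encNat : ℕ → Data
  | 0 => Data.nil
  | k + 1 => Data.cons Data.nil (encNat k)

def encList : List Data → Data
  | [] => Data.nil
  | a :: l => Data.cons a (encList l)

/-- The order `π`, as the list of the positions of `x_0, …, x_{n-1}`. -/
def encPerm {n : ℕ} (π : Equiv.Perm (Fin n)) : Data :=
  encList (List.ofFn fun i => encNat (π i : ℕ))

/-- A clause, as the list that says for each variable whether it occurs positively (`1`),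
negatively (`2`) or not at all (`0`). -/
def encClause {n : ℕ} (C : Clause n) : Data :=
  encList (List.ofFn fun i =>
    if (i, true) ∈ C.lits then encNat 1 else if (i, false) ∈ C.lits then encNat 2 else encNat 0)

def encJust : Just → Data
  | Just.ax => Data.nil
  | Just.res j k => Data.cons (encNat j) (encNat k)

def encLine {n : ℕ} (L : Line n) : Data := Data.cons (encClause L.clause) (encJust L.just)

def encProof {n : ℕ} (P : Proof n) : Data := encList (P.map encLine)

/-- The input of a simulation: an order together with a proof. -/
def encInput {n : ℕ} (π : Equiv.Perm (Fin n)) (P : Proof n) : Data :=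
  Data.cons (encPerm π) (encProof P)

/-! Simulations. -/

/-- The program `p` is a polynomial-time algorithm that takes every `Q`-refutation, with respect to
any order `π` of any number `n` of variables, to a `P`-refutation with respect to `π` from the
same axioms, whose number of lines is polynomial in that of the given refutation.
The program and the polynomials do not depend on `n` and `π`. -/
def IsPSimulation (P Q : System) (p : Prog) : Prop :=
  ∃ T q : Polynomial ℕ, ∀ (n : ℕ) (π : Equiv.Perm (Fin n)) (τ : Set (Clause n)) (Γ : Proof n),
    Refutes Q π τ Γ →
      ∃ (Δ : Proof n) (t : ℕ), Run p (encInput π Γ) (encProof Δ) t ∧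
        t ≤ T.eval (encInput π Γ).size ∧ Refutes P π τ Δ ∧ Δ.length ≤ q.eval Γ.length

/-- `P` p-simulates `Q`. -/
def PSimulates (P Q : System) : Prop := ∃ p : Prog, IsPSimulation P Q p

/-- `P` and `Q` are polynomially equivalent. -/
def PolyEquivalent (P Q : System) : Prop := PSimulates P Q ∧ PSimulates Q P

end OrdRes

/-!
Assume that all literals of a given clause are false and propagate through the clauses derived so
far in increasing order of the variables: a clause whose largest literal is the only one not yet
false forces that literal. The simulation keeps every line `C` covered: under the assumption that
`C` is false, propagation makes some derived clause false of which the largest literal belongs to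
`C`. For the empty `C` this means that the empty clause has been derived.

Let `C` be a half-ordered resolvent on `x` of covered clauses. In the antecedent whose other
variables are below `x`, either a literal of `C` witnesses that `C` is covered, or a derived clause
forces the value of `x`; then the other antecedent covers `C` or forces the opposite value. In the
last case two derived clauses, the reasons, agree except for the sign of their largest literal, and
their resolvent is an ordered one. It is false, and as long as its largest literal was forced
rather than assumed, we resolve it with the reason for that literal. These steps are ordered, the
largest variable decreases, and the last clause covers `C`. So each line costs at most `n` new ones.

The reasons used for one line have distinct largest variables. Only the last clause derived for a
line can have a largest variable that no earlier clause had, so after `m` lines there are at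
most `m` largest variables. This bounds the number of derived clauses by `m * (m + 1)`,
independently of `n`.
-/

namespace OrdRes

theorem eval_mono (T : Polynomial ℕ) : Monotone fun k => T.eval k := by
  intro a b h
  simp only [Polynomial.eval_eq_sum, Polynomial.sum]
  gcongr

theorem Data.one_le_size (v : Data) : 1 ≤ v.size := by
  cases v <;> simp [Data.size]

theorem Data.size_head_le (v : Data) : v.head.size ≤ v.size := by
  cases v <;> simp only [Data.size, Data.head] <;> omega

theorem Data.size_tail_le (v : Data) : v.tail.size ≤ v.size := by
  cases v <;> simp only [Data.size, Data.tail] <;> omega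

theorem Run.size_le {p : Prog} {v w : Data} {t : ℕ} (h : Run p v w t) :
    w.size ≤ v.size + t := by
  induction h with
  | id v => omega
  | nil v => simp [Data.size]
  | head v => have := v.size_head_le; omega
  | tail v => have := v.size_tail_le; omega
  | _ => omega

theorem Run.deterministic {p : Prog} {v w w' : Data} {t t' : ℕ} (h : Run p v w t)
    (h' : Run p v w' t') : w = w' := by
  induction h generalizing w' t' with
  | id v | nil v | head v | tail v => cases h'; rfl
  | cons _ _ ihf ihg => cases h' with | cons hf hg => rw [ihf hf, ihg hg]
  | seq _ _ ihf ihg => cases h' with | seq hf hg => obtain rfl := ihf hf; exact ihg hg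
  | ite_true _ hb _ ihc ihf =>
    cases h' with
    | ite_true hc hb' hf => exact ihf hf
    | ite_false hc hg => exact absurd (ihc hc) hb
  | ite_false _ _ ihc ihg =>
    cases h' with
    | ite_true hc hb hf => exact absurd (ihc hc).symm hb
    | ite_false hc hg => exact ihg hg
  | loop_done _ ihc =>
    cases h' with
    | loop_done hc => rfl
    | loop_step hc hb hf hl => exact absurd (ihc hc).symm hb
  | loop_step _ hb _ _ ihc ihf ihl =>
    cases h' with
    | loop_done hc => exact absurd (ihc hc) hb
    | loop_step hc hb' hf hl => obtain rfl := ihf hf; exact ihl hl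

/-- The program `p` halts on `v` with output `w`, in time at most `T`. -/
def RunLE (p : Prog) (v w : Data) (T : ℕ) : Prop := ∃ t ≤ T, Run p v w t

namespace RunLE

variable {c f g p : Prog} {a b u v w : Data} {R S T : ℕ}

theorem mono (h : RunLE p v w S) (hST : S ≤ T) : RunLE p v w T :=
  h.imp fun _ h => ⟨h.1.trans hST, h.2⟩

theorem cons (hf : RunLE f v a S) (hg : RunLE g v b T) :
    RunLE (.cons f g) v (.cons a b) (2 * S + 2 * T + 2 * v.size + 1) := by
  obtain ⟨s, hs, hf⟩ := hf
  obtain ⟨t, ht, hg⟩ := hg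
  refine ⟨_, ?_, .cons hf hg⟩
  have ha := hf.size_le
  have hb := hg.size_le
  simp only [Data.size]
  omega

theorem seq (hf : RunLE f v u S) (hg : RunLE g u w T) : RunLE (.seq f g) v w (S + T + 1) := by
  obtain ⟨s, hs, hf⟩ := hf
  obtain ⟨t, ht, hg⟩ := hg
  exact ⟨_, by omega, .seq hf hg⟩

theorem ite_true (hc : RunLE c v b S) (hb : b ≠ .nil) (hf : RunLE f v w T) :
    RunLE (.ite c f g) v w (S + T + 1) := by
  obtain ⟨s, hs, hc⟩ := hc
  obtain ⟨t, ht, hf⟩ := hf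
  exact ⟨_, by omega, .ite_true hc hb hf⟩

theorem ite_false (hc : RunLE c v .nil S) (hg : RunLE g v w T) :
    RunLE (.ite c f g) v w (S + T + 1) := by
  obtain ⟨s, hs, hc⟩ := hc
  obtain ⟨t, ht, hg⟩ := hg
  exact ⟨_, by omega, .ite_false hc hg⟩

theorem loop_done (hc : RunLE c v .nil S) : RunLE (.loop c f) v v (S + 1) := by
  obtain ⟨s, hs, hc⟩ := hc
  exact ⟨_, by omega, .loop_done hc⟩

theorem loop_step (hc : RunLE c v b R) (hb : b ≠ .nil) (hf : RunLE f v u S)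
    (hl : RunLE (.loop c f) u w T) : RunLE (.loop c f) v w (R + S + T + 1) := by
  obtain ⟨r, hr, hc⟩ := hc
  obtain ⟨s, hs, hf⟩ := hf
  obtain ⟨t, ht, hl⟩ := hl
  exact ⟨_, by omega, .loop_step hc hb hf hl⟩

theorem loop {x : ℕ → Data} {k : ℕ} (hc : ∀ i < k, ∃ b ≠ .nil, RunLE c (x i) b R)
    (hend : RunLE c (x k) .nil R) (hf : ∀ i < k, RunLE f (x i) (x (i + 1)) S) :
    RunLE (.loop c f) (x 0) (x k) ((k + 1) * (R + S + 1)) := by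
  induction k generalizing x with
  | zero => exact hend.loop_done.mono (by omega)
  | succ k ih =>
    obtain ⟨b, hb, hc₀⟩ := hc 0 k.succ_pos
    have hl := ih (x := fun i => x (i + 1)) (fun i hi => hc _ (by omega)) hend
      fun i hi => hf _ (by omega)
    exact (hc₀.loop_step hb (hf 0 k.succ_pos) hl).mono (by rw [Nat.succ_mul (k + 1)]; omega)

end RunLE

/-! ### Functions computable in polynomial time -/

/-- A type whose elements are written as data, so that programs can compute with them. -/
class Enc (α : Type) where
  enc : α → Data

open Enc (enc)

instance : Enc Data := ⟨id⟩

instance : Enc Unit := ⟨fun _ => .nil⟩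

/-- The value `true` is written as `nil`, so that the code of `Option Bool` is the one that
`encClause` uses for the entries of a clause. -/
instance : Enc Bool := ⟨fun b => bif b then .nil else .cons .nil .nil⟩

instance : Enc ℕ := ⟨encNat⟩

instance : Enc Just := ⟨encJust⟩

section

variable {α β γ σ : Type} [Enc α] [Enc β] [Enc γ] [Enc σ]

instance {p : α → Prop} : Enc (Subtype p) := ⟨fun a => enc a.1⟩

instance : Enc (Option α) := ⟨fun o => o.elim .nil fun a => .cons .nil (enc a)⟩

instance : Enc (α × β) := ⟨fun x => .cons (enc x.1) (enc x.2)⟩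

instance : Enc (List α) := ⟨fun l => encList (l.map enc)⟩

theorem enc_bool_eq_nil {b : Bool} : enc b = .nil ↔ b = true := by
  cases b <;> simp [enc]

theorem enc_option_eq_nil {o : Option α} : enc o = .nil ↔ o = none := by
  cases o <;> simp [enc]

theorem enc_list_eq_nil {l : List α} : enc l = .nil ↔ l = [] := by
  cases l <;> simp [enc, encList]

/-- The size of the data that encode `a`. -/
def encSize (a : α) : ℕ := (enc a).size

theorem one_le_encSize (a : α) : 1 ≤ encSize a := Data.one_le_size _

theorem encSize_pair (a : α) (b : β) : encSize (a, b) = encSize a + encSize b + 1 := rfl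

theorem encSize_nil : encSize ([] : List α) = 1 := rfl

theorem encSize_cons (a : α) (l : List α) : encSize (a :: l) = encSize a + encSize l + 1 := rfl

theorem encSize_none : encSize (none : Option α) = 1 := rfl

theorem encSize_some (a : α) : encSize (some a) = encSize a + 2 := by
  change 1 + encSize a + 1 = _
  omega

theorem encSize_nat (k : ℕ) : encSize k = 2 * k + 1 := by
  induction k with
  | zero => rfl
  | succ k ih =>
    change 1 + encSize k + 1 = _
    omega

theorem encSize_append (l m : List α) : encSize (l ++ m) + 1 = encSize l + encSize m := by
  induction l with
  | nil => rw [List.nil_append, encSize_nil, Nat.add_comm]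
  | cons b l ih => rw [List.cons_append, encSize_cons, encSize_cons]; omega

theorem encSize_reverse (l : List α) : encSize l.reverse = encSize l := by
  induction l with
  | nil => rfl
  | cons b l ih =>
    have h := encSize_append l.reverse [b]
    rw [encSize_cons, encSize_nil] at h
    rw [List.reverse_cons, encSize_cons]
    omega

theorem encSize_le_of_prefix {l m : List α} (h : l <+: m) : encSize l ≤ encSize m := by
  obtain ⟨k, rfl⟩ := h
  have := encSize_append l k
  have := one_le_encSize k
  omega

theorem encSize_le_of_suffix {l m : List α} (h : l <:+ m) : encSize l ≤ encSize m := by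
  simpa only [encSize_reverse] using encSize_le_of_prefix (List.reverse_prefix.2 h)

theorem encSize_le_of_mem {l : List α} {a : α} (h : a ∈ l) : encSize a ≤ encSize l := by
  obtain ⟨k, m, rfl⟩ := List.append_of_mem h
  have := encSize_append k (a :: m)
  rw [encSize_cons] at this
  have := one_le_encSize k
  omega

theorem length_le_encSize (l : List α) : l.length ≤ encSize l := by
  induction l with
  | nil => exact Nat.zero_le _
  | cons a l ih => rw [encSize_cons, List.length_cons]; omega

theorem encSize_list_le {l : List α} {M : ℕ} (h : ∀ a ∈ l, encSize a ≤ M) :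
    encSize l ≤ l.length * (M + 1) + 1 := by
  induction l with
  | nil => simp [encSize_nil]
  | cons a l ih =>
    have ha := h a List.mem_cons_self
    have hl := ih fun b hb => h b (List.mem_cons_of_mem a hb)
    rw [encSize_cons, List.length_cons, Nat.succ_mul]
    omega

/-- `g a` is at most polynomial in the size of `a`. -/
def PolyBound (g : α → ℕ) : Prop := ∃ T : Polynomial ℕ, ∀ a, g a ≤ T.eval (encSize a)

namespace PolyBound

variable {f g : α → ℕ}

theorem mono (hg : PolyBound g) (h : ∀ a, f a ≤ g a) : PolyBound f :=
  hg.imp fun _ hT a => (h a).trans (hT a)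

theorem const (k : ℕ) : PolyBound fun _ : α => k := ⟨.C k, fun a => by simp⟩

theorem size : PolyBound fun a : α => encSize a := ⟨.X, fun a => by simp⟩

theorem add (hf : PolyBound f) (hg : PolyBound g) : PolyBound fun a => f a + g a := by
  obtain ⟨S, hS⟩ := hf
  obtain ⟨T, hT⟩ := hg
  exact ⟨S + T, fun a => by rw [Polynomial.eval_add]; exact Nat.add_le_add (hS a) (hT a)⟩

theorem mul (hf : PolyBound f) (hg : PolyBound g) : PolyBound fun a => f a * g a := by
  obtain ⟨S, hS⟩ := hf
  obtain ⟨T, hT⟩ := hg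
  exact ⟨S * T, fun a => by rw [Polynomial.eval_mul]; exact Nat.mul_le_mul (hS a) (hT a)⟩

theorem eval (hf : PolyBound f) (S : Polynomial ℕ) : PolyBound fun a => S.eval (f a) := by
  obtain ⟨T, hT⟩ := hf
  exact ⟨S.comp T, fun a => by rw [Polynomial.eval_comp]; exact eval_mono S (hT a)⟩

theorem comp {f : β → ℕ} (hf : PolyBound f) {g : α → β} (hg : PolyBound fun a => encSize (g a)) :
    PolyBound fun a => f (g a) :=
  hf.elim fun S hS => (hg.eval S).mono fun _ => hS _

end PolyBound

/-- The function `f` is computed by a program in polynomial time. -/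
@[fun_prop]
def PolyTime (f : α → β) : Prop :=
  ∃ (p : Prog) (T : α → ℕ), PolyBound T ∧ ∀ a, RunLE p (enc a) (enc (f a)) (T a)

namespace PolyTime

theorem congr {f g : α → β} (hf : PolyTime f) (h : ∀ a, g a = f a) : PolyTime g := by
  rwa [funext h]

theorem bound {f : α → β} (hf : PolyTime f) : PolyBound fun a => encSize (f a) := by
  obtain ⟨p, T, hT, h⟩ := hf
  refine (PolyBound.size.add hT).mono fun a => ?_
  obtain ⟨t, ht, hr⟩ := h a
  exact hr.size_le.trans (Nat.add_le_add_left ht _)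

@[fun_prop]
theorem id : PolyTime fun a : α => a := ⟨.id, _, .size, fun _ => ⟨_, le_rfl, .id _⟩⟩

@[fun_prop]
theorem comp {g : β → γ} (hg : PolyTime g) {f : α → β} (hf : PolyTime f) :
    PolyTime fun a => g (f a) := by
  have hb := hf.bound
  obtain ⟨p, S, hS, hf⟩ := hf
  obtain ⟨q, T, hT, hg⟩ := hg
  exact ⟨.seq p q, _, (hS.add (hT.comp hb)).add (.const 1), fun a => (hf a).seq (hg _)⟩

section

variable {f : α → β} {g : α → γ}

theorem of_enc_eq (hg : PolyTime g) (h : ∀ a, enc (f a) = enc (g a)) : PolyTime f := by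
  simpa only [PolyTime, h] using hg

theorem of_head (hg : PolyTime g) (h : ∀ a, enc (f a) = (enc (g a)).head) : PolyTime f :=
  of_enc_eq (comp (g := fun b => (enc b).head)
    ⟨.head, _, .size, fun _ => ⟨_, le_rfl, .head _⟩⟩ hg) h

theorem of_tail (hg : PolyTime g) (h : ∀ a, enc (f a) = (enc (g a)).tail) : PolyTime f :=
  of_enc_eq (comp (g := fun b => (enc b).tail)
    ⟨.tail, _, .size, fun _ => ⟨_, le_rfl, .tail _⟩⟩ hg) h

theorem of_cons {k : α → σ} (hf : PolyTime f) (hg : PolyTime g)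
    (hk : ∀ a, enc (k a) = .cons (enc (f a)) (enc (g a))) : PolyTime k := by
  obtain ⟨p, S, hS, hf⟩ := hf
  obtain ⟨q, T, hT, hg⟩ := hg
  refine ⟨.cons p q, _, ((((PolyBound.const 2).mul hS).add ((PolyBound.const 2).mul hT)).add
    ((PolyBound.const 2).mul .size)).add (.const 1), fun a => ?_⟩
  rw [hk]
  exact (hf a).cons (hg a)

theorem of_ite {c : α → γ} {k : α → β} (hc : PolyTime c)
    (hf : PolyTime fun a : {a // enc (c a) ≠ .nil} => k a)
    (hg : PolyTime fun a : {a // enc (c a) = .nil} => k a) : PolyTime k := by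
  obtain ⟨r, R, hR, hc⟩ := hc
  obtain ⟨p, S, ⟨S', hS⟩, hf⟩ := hf
  obtain ⟨q, T, ⟨T', hT⟩, hg⟩ := hg
  refine ⟨.ite r p q, _, (hR.add ((PolyBound.size.eval S').add (PolyBound.size.eval T'))).add
    (.const 1), fun a => ?_⟩
  have hca := hc a
  by_cases hn : enc (c a) = .nil
  · rw [hn] at hca
    have := hT ⟨a, hn⟩
    exact (hca.ite_false (hg ⟨a, hn⟩)).mono (by change _ ≤ T'.eval (encSize a) at this; omega)
  · have := hS ⟨a, hn⟩
    exact (hca.ite_true hn (hf ⟨a, hn⟩)).mono (by change _ ≤ S'.eval (encSize a) at this; omega)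

end

@[fun_prop]
theorem const (b : β) : PolyTime fun _ : α => b := by
  suffices ∀ d : Data, PolyTime fun _ : α => d from of_enc_eq (this (enc b)) fun _ => rfl
  intro d
  induction d with
  | nil => exact ⟨.nil, _, .const 1, fun _ => ⟨_, le_rfl, .nil _⟩⟩
  | cons d e ihd ihe => exact of_cons ihd ihe fun _ => rfl

@[fun_prop]
theorem val {p : α → Prop} {f : β → Subtype p} (hf : PolyTime f) : PolyTime fun b => (f b).1 :=
  of_enc_eq hf fun _ => rfl

@[fun_prop]
theorem fst {f : α → β × γ} (hf : PolyTime f) : PolyTime fun a => (f a).1 :=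
  of_head hf fun _ => rfl

@[fun_prop]
theorem snd {f : α → β × γ} (hf : PolyTime f) : PolyTime fun a => (f a).2 :=
  of_tail hf fun _ => rfl

@[fun_prop]
theorem pair {f : α → β} {g : α → γ} (hf : PolyTime f) (hg : PolyTime g) :
    PolyTime fun a => (f a, g a) := of_cons hf hg fun _ => rfl

@[fun_prop]
theorem cond {c : α → Bool} {f g : α → β} (hc : PolyTime c) (hf : PolyTime f) (hg : PolyTime g) :
    PolyTime fun a => bif c a then f a else g a := by
  refine of_ite hc ((hg.comp (val id)).congr fun a => ?_) ((hf.comp (val id)).congr fun a => ?_)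
  · rw [eq_false_of_ne_true (mt enc_bool_eq_nil.2 a.2), cond_false]
  · rw [enc_bool_eq_nil.1 a.2, cond_true]

@[fun_prop]
theorem not {c : α → Bool} (hc : PolyTime c) : PolyTime fun a => !c a :=
  (hc.cond (const false) (const true)).congr fun a => by cases c a <;> rfl

@[fun_prop]
theorem and {c d : α → Bool} (hc : PolyTime c) (hd : PolyTime d) : PolyTime fun a => c a && d a :=
  (hc.cond hd (const false)).congr fun a => by cases c a <;> rfl

@[fun_prop]
theorem some {f : α → β} (hf : PolyTime f) : PolyTime fun a => Option.some (f a) :=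
  of_cons (const ()) hf fun _ => rfl

@[fun_prop]
theorem elim {o : γ → Option α} {f : γ → β} {g : γ → α → β} (ho : PolyTime o)
    (hf : PolyTime f) (hg : PolyTime fun x : γ × α => g x.1 x.2) :
    PolyTime fun c => (o c).elim (f c) (g c) := by
  have ne_none (c : {c // enc (o c) ≠ .nil}) : (o c).isSome :=
    Option.isSome_iff_ne_none.2 (mt enc_option_eq_nil.2 c.2)
  have hget : PolyTime fun c : {c // enc (o c) ≠ .nil} => (o c).get (ne_none c) :=
    of_tail (ho.comp (val id)) fun c => by
      conv_rhs => rw [← Option.some_get (ne_none c)]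
      rfl
  refine of_ite ho ((hg.comp ((val id).pair hget)).congr fun c => ?_)
    ((hf.comp (val id)).congr fun c => ?_)
  · conv_lhs => rw [← Option.some_get (ne_none c)]
    rfl
  · rw [enc_option_eq_nil.1 c.2, Option.elim_none]

@[fun_prop]
theorem list_cons {f : α → β} {g : α → List β} (hf : PolyTime f) (hg : PolyTime g) :
    PolyTime fun a => f a :: g a := of_cons hf hg fun _ => rfl

@[fun_prop]
theorem list_tail {l : α → List β} (hl : PolyTime l) : PolyTime fun a => (l a).tail :=
  of_tail hl fun a => by cases l a <;> rfl

@[fun_prop]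
theorem list_head? {l : α → List β} (hl : PolyTime l) : PolyTime fun a => (l a).head? := by
  refine of_ite hl ?_ ?_
  · refine of_cons (const ()) (of_head (f := fun a : {a // enc (l a) ≠ .nil} => (enc (l a)).head)
      (hl.comp (val id)) fun _ => rfl) ?_
    rintro ⟨a, ha⟩
    obtain ⟨b, m, h⟩ := List.exists_cons_of_ne_nil (mt enc_list_eq_nil.2 ha)
    simp only [h]
    rfl
  · exact (const none).congr fun a => by rw [enc_list_eq_nil.1 a.2, List.head?_nil]

/-- The number `k c` of iterations need not be computable: the loop is left because of `g`. -/
theorem iterate {x : γ → ℕ → α} {f : α → α} {g : α → β} {k B : γ → ℕ}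
    (hx : PolyTime fun c => x c 0) (hf : PolyTime f) (hg : PolyTime g)
    (hstep : ∀ c, ∀ i < k c, x c (i + 1) = f (x c i))
    (hlt : ∀ c, ∀ i < k c, enc (g (x c i)) ≠ .nil) (hend : ∀ c, enc (g (x c (k c))) = .nil)
    (hk : PolyBound k) (hB : PolyBound B) (hxB : ∀ c, ∀ i ≤ k c, encSize (x c i) ≤ B c) :
    PolyTime fun c => x c (k c) := by
  obtain ⟨q, R, ⟨R', hR⟩, hq⟩ := hg
  obtain ⟨p, S, ⟨S', hS⟩, hp⟩ := hf
  obtain ⟨r, T, hT, hr⟩ := hx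
  refine ⟨.seq r (.loop q p), _, (hT.add ((hk.add (.const 1)).mul
    (((hB.eval R').add (hB.eval S')).add (.const 1)))).add (.const 1), fun c => (hr c).seq ?_⟩
  have hq' (i) (hi : i ≤ k c) := (hq (x c i)).mono ((hR _).trans (eval_mono R' (hxB c i hi)))
  have hp' (i) (hi : i ≤ k c) := (hp (x c i)).mono ((hS _).trans (eval_mono S' (hxB c i hi)))
  refine RunLE.loop (x := fun i => enc (x c i)) (fun i hi => ⟨_, hlt c i hi, hq' i hi.le⟩) ?_ ?_
  · rw [← hend c]
    exact hq' _ le_rfl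
  · intro i hi
    rw [hstep c i hi]
    exact hp' i hi.le

theorem foldl {l : γ → List α} {s : γ → σ} {f : γ → σ → α → σ} {B : γ → ℕ} (hl : PolyTime l)
    (hs : PolyTime s) (hf : PolyTime fun x : γ × σ × α => f x.1 x.2.1 x.2.2) (hB : PolyBound B)
    (hfB : ∀ c l', l' <+: l c → encSize (l'.foldl (f c) (s c)) ≤ B c) :
    PolyTime fun c => (l c).foldl (f c) (s c) := by
  let x : γ → ℕ → γ × σ × List α := fun c i =>
    (c, ((l c).take i).foldl (f c) (s c), (l c).drop i)
  let step : γ × σ × List α → γ × σ × List α := fun x =>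
    x.2.2.head?.elim x fun a => (x.1, f x.1 x.2.1 a, x.2.2.tail)
  have hstep : PolyTime step := by
    refine elim (by fun_prop) id (pair (by fun_prop) (pair ?_ (by fun_prop)))
    exact hf.comp (f := fun y : (γ × σ × List α) × α => (y.1.1, y.1.2.1, y.2)) (by fun_prop)
  have hx : PolyTime fun c => x c (l c).length := by
    refine iterate (f := step) (g := fun x => x.2.2)
      (B := fun c => encSize c + B c + encSize (l c) + 2)
      (by simp only [x, List.take_zero, List.foldl_nil, List.drop_zero]; fun_prop) hstep
      (by fun_prop) (fun c i hi => ?_) (fun c i hi => ?_) (fun c => ?_)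
      (hl.bound.mono fun c => length_le_encSize _)
      (((PolyBound.size.add hB).add hl.bound).add (.const 2)) (fun c i _ => ?_)
    · simp only [x, step, List.drop_eq_getElem_cons hi, List.take_succ_eq_append_getElem hi,
        List.foldl_append, List.foldl_cons, List.foldl_nil, List.head?_cons, Option.elim_some,
        List.tail_cons]
    · simpa [x, enc_list_eq_nil] using hi
    · simp [x, enc_list_eq_nil]
    · have hfold := hfB c _ (List.take_prefix i (l c))
      have hdrop := encSize_le_of_suffix (List.drop_suffix i (l c))
      simp only [x, encSize_pair]
      omega
  exact hx.snd.fst.congr fun c => by simp only [x, List.take_length]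

@[fun_prop]
theorem list_reverse {l : γ → List α} (hl : PolyTime l) : PolyTime fun c => (l c).reverse := by
  have h (m : List α) : m.foldl (fun s a => a :: s) [] = m.reverse := by simp
  refine (foldl (s := fun _ => []) (f := fun _ s a => a :: s) hl (by fun_prop) (by fun_prop)
    hl.bound fun c l' hl' => ?_).congr fun c => (h _).symm
  rw [h, encSize_reverse]
  exact encSize_le_of_prefix hl'

@[fun_prop]
theorem list_map {l : γ → List α} {f : γ → α → β} (hl : PolyTime l)
    (hf : PolyTime fun x : γ × α => f x.1 x.2) : PolyTime fun c => (l c).map (f c) := by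
  obtain ⟨T, hT⟩ := hf.bound
  have hB := (PolyBound.size.add hl.bound).add (.const (α := γ) 1)
  have h (c) (m : List α) : m.foldl (fun s a => f c a :: s) [] = (m.map (f c)).reverse := by
    rw [List.foldl_flip_cons_eq_append, List.append_nil]
  have hrev : PolyTime fun c => (l c).foldl (fun s a => f c a :: s) [] := by
    refine foldl (s := fun _ => []) (f := fun c s a => f c a :: s) hl (by fun_prop)
      (list_cons (hf.comp (f := fun x : γ × List β × α => (x.1, x.2.2)) (by fun_prop))
        (by fun_prop)) (((hl.bound).mul ((hB.eval T).add (.const 1))).add (.const 1)) ?_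
    intro c l' hl'
    have hf_le : ∀ b ∈ l'.map (f c), encSize b ≤ T.eval (encSize c + encSize (l c) + 1) := by
      refine List.forall_mem_map.2 fun a ha => (hT (c, a)).trans (eval_mono T ?_)
      have := encSize_le_of_mem (hl'.subset ha)
      rw [encSize_pair]
      omega
    rw [h, encSize_reverse]
    refine (encSize_list_le hf_le).trans (Nat.add_le_add_right (Nat.mul_le_mul_right _ ?_) 1)
    rw [List.length_map]
    exact hl'.length_le.trans (length_le_encSize _)
  exact hrev.list_reverse.congr fun c => by rw [h, List.reverse_reverse]

@[fun_prop]
theorem list_find? {l : γ → List α} {p : γ → α → Bool} (hl : PolyTime l)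
    (hp : PolyTime fun x : γ × α => p x.1 x.2) : PolyTime fun c => (l c).find? (p c) := by
  have h (c) (m : List α) (s : Option α) :
      m.foldl (fun s a => s.elim (bif p c a then Option.some a else none) Option.some) s =
        s.elim (m.find? (p c)) Option.some := by
    induction m generalizing s with
    | nil => cases s <;> rfl
    | cons a m ih => rw [List.foldl_cons, ih, List.find?_cons]; cases s <;> cases p c a <;> rfl
  refine (foldl (s := fun _ => none) (B := fun c => encSize (l c) + 2)
    (f := fun c s a => s.elim (bif p c a then Option.some a else none) Option.some) hl
    (by fun_prop) (elim (by fun_prop) (cond ?_ (by fun_prop) (by fun_prop)) (by fun_prop))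
    (hl.bound.add (.const 2)) fun c l' hl' => ?_).congr fun c => (h c _ none).symm
  · exact hp.comp (f := fun x : γ × Option α × α => (x.1, x.2.2)) (by fun_prop)
  · rw [h, Option.elim_none]
    cases hfind : l'.find? (p c) with
    | none => rw [encSize_none]; omega
    | some a =>
      have := encSize_le_of_mem (hl'.subset (List.mem_of_find?_eq_some hfind))
      rw [encSize_some]
      omega

@[fun_prop]
theorem option_isNone {o : γ → Option α} (ho : PolyTime o) : PolyTime fun c => (o c).isNone :=
  (ho.elim (const true) (const false)).congr fun c => by cases o c <;> rfl

@[fun_prop]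
theorem option_join {o : γ → Option (Option α)} (ho : PolyTime o) : PolyTime fun c => (o c).join :=
  (ho.elim (g := fun _ a => a) (const none) (by fun_prop)).congr fun c => by cases o c <;> rfl

@[fun_prop]
theorem list_isEmpty {l : γ → List α} (hl : PolyTime l) : PolyTime fun c => (l c).isEmpty :=
  hl.list_head?.option_isNone.congr fun c => by cases l c <;> rfl

@[fun_prop]
theorem list_all {l : γ → List α} {p : γ → α → Bool} (hl : PolyTime l)
    (hp : PolyTime fun x : γ × α => p x.1 x.2) : PolyTime fun c => (l c).all (p c) :=
  (hl.list_find? (p := fun c a => !p c a) (by fun_prop)).option_isNone.congr fun c => by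
    rw [Bool.eq_iff_iff]
    simp

@[fun_prop]
theorem list_length {l : γ → List α} (hl : PolyTime l) : PolyTime fun c => (l c).length := by
  refine of_enc_eq (hl.list_map (f := fun _ _ => ()) (const _)) fun c => ?_
  induction l c with
  | nil => rfl
  | cons _ m ih => exact congrArg (Data.cons .nil) ih

@[fun_prop]
theorem replicate_unit {k : γ → ℕ} (hk : PolyTime k) :
    PolyTime fun c => List.replicate (k c) () := by
  refine of_enc_eq hk fun c => ?_
  induction k c with
  | zero => rfl
  | succ k ih => exact congrArg (Data.cons .nil) ih

@[fun_prop]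
theorem list_drop {k : γ → ℕ} {l : γ → List α} (hk : PolyTime k) (hl : PolyTime l) :
    PolyTime fun c => (l c).drop (k c) := by
  have h (m : List Unit) (s : List α) : m.foldl (fun s _ => s.tail) s = s.drop m.length := by
    induction m generalizing s with
    | nil => rfl
    | cons a m ih => rw [List.foldl_cons, ih, List.length_cons, List.drop_tail]
  refine (foldl (f := fun _ s _ => s.tail) hk.replicate_unit hl (by fun_prop) hl.bound
    fun c l' _ => ?_).congr fun c => ?_
  · rw [h]
    exact encSize_le_of_suffix (List.drop_suffix _ _)
  · rw [h, List.length_replicate]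

@[fun_prop]
theorem nat_beq {j k : γ → ℕ} (hj : PolyTime j) (hk : PolyTime k) :
    PolyTime fun c => j c == k c := by
  refine ((hj.list_drop hk.replicate_unit).list_isEmpty.and
    (hk.list_drop hj.replicate_unit).list_isEmpty).congr fun c => ?_
  rw [Bool.eq_iff_iff]
  simp only [beq_iff_eq, Bool.and_eq_true, List.isEmpty_iff, List.drop_eq_nil_iff,
    List.length_replicate]
  omega

@[fun_prop]
theorem bool_beq {b c : γ → Bool} (hb : PolyTime b) (hc : PolyTime c) :
    PolyTime fun a => b a == c a :=
  (hb.cond hc hc.not).congr fun a => by cases b a <;> cases c a <;> rfl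

@[fun_prop]
theorem option_beq [BEq α] {o p : γ → Option α} (ho : PolyTime o) (hp : PolyTime p)
    (h : PolyTime fun x : α × α => x.1 == x.2) : PolyTime fun c => o c == p c := by
  refine (elim (g := fun c a => (p c).elim false fun b => a == b) ho hp.option_isNone
    (elim (by fun_prop) (const _) ?_)).congr fun c => ?_
  · exact h.comp (f := fun x : (γ × α) × α => (x.1.2, x.2)) (by fun_prop)
  · cases o c <;> cases p c <;> rfl

@[fun_prop]
theorem list_zip {l : γ → List α} {m : γ → List β} (hl : PolyTime l) (hm : PolyTime m) :
    PolyTime fun c => (l c).zip (m c) := by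
  let step : List (α × β) × List β → α → List (α × β) × List β := fun s a =>
    (s.2.head?.elim s.1 fun b => (a, b) :: s.1, s.2.tail)
  have h (l : List α) (s) : l.foldl step s = ((l.zip s.2).reverse ++ s.1, s.2.drop l.length) := by
    induction l generalizing s with
    | nil => rfl
    | cons a l ih => rw [List.foldl_cons, ih]; rcases s with ⟨s, _ | ⟨b, m⟩⟩ <;> simp [step]
  have hzip (l : List α) (m : List β) : encSize (l.zip m) ≤ encSize l + encSize m := by
    induction l generalizing m with
    | nil => exact Nat.le_add_right _ _
    | cons a l ih =>
      cases m with
      | nil => exact Nat.le_add_left _ _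
      | cons b m =>
        rw [List.zip_cons_cons, encSize_cons, encSize_cons, encSize_cons, encSize_pair]
        have := ih m
        omega
  refine (foldl (s := fun c => ([], m c)) (f := fun _ => step)
    (B := fun c => encSize (l c) + 2 * encSize (m c) + 1) hl (by fun_prop) (by fun_prop)
    ((hl.bound.add ((PolyBound.const 2).mul hm.bound)).add (.const 1))
    fun c l' hl' => ?_).fst.list_reverse.congr fun c => ?_
  · rw [h, List.append_nil, encSize_pair, encSize_reverse]
    have := hzip l' (m c)
    have := encSize_le_of_prefix hl'
    have := encSize_le_of_suffix (List.drop_suffix l'.length (m c))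
    dsimp only
    omega
  · rw [h, List.append_nil, List.reverse_reverse]

@[fun_prop]
theorem list_zipWith {l : γ → List α} {m : γ → List β} {f : γ → α → β → σ} (hl : PolyTime l)
    (hm : PolyTime m) (hf : PolyTime fun x : γ × α × β => f x.1 x.2.1 x.2.2) :
    PolyTime fun c => List.zipWith (f c) (l c) (m c) :=
  (list_map (f := fun c x => f c x.1 x.2) (hl.list_zip hm) hf).congr fun c => by
    rw [List.zip, List.map_zipWith]

@[fun_prop]
theorem or {c d : γ → Bool} (hc : PolyTime c) (hd : PolyTime d) : PolyTime fun a => c a || d a :=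
  (hc.cond (const true) hd).congr fun a => by cases c a <;> rfl

@[fun_prop]
theorem option_isSome {o : γ → Option α} (ho : PolyTime o) : PolyTime fun c => (o c).isSome :=
  ho.option_isNone.not.congr fun c => by cases o c <;> rfl

@[fun_prop]
theorem option_or {o p : γ → Option α} (ho : PolyTime o) (hp : PolyTime p) :
    PolyTime fun c => (o c).or (p c) :=
  (ho.elim (g := fun _ a => Option.some a) hp (by fun_prop)).congr fun c => by cases o c <;> rfl

theorem foldr {l : γ → List α} {s : γ → σ} {f : γ → α → σ → σ} {B : γ → ℕ} (hl : PolyTime l)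
    (hs : PolyTime s) (hf : PolyTime fun x : γ × α × σ => f x.1 x.2.1 x.2.2) (hB : PolyBound B)
    (hfB : ∀ c l', l' <:+ l c → encSize (l'.foldr (f c) (s c)) ≤ B c) :
    PolyTime fun c => (l c).foldr (f c) (s c) := by
  refine (foldl (f := fun c s a => f c a s) hl.list_reverse hs
    (hf.comp (f := fun x : γ × σ × α => (x.1, x.2.2, x.2.1)) (by fun_prop)) hB
    fun c l' hl' => ?_).congr fun c => List.foldl_reverse.symm
  rw [List.foldl_eq_foldr_reverse]
  exact hfB c _ (by simpa using List.reverse_suffix.2 hl')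

@[fun_prop]
theorem list_tails {l : γ → List α} (hl : PolyTime l) : PolyTime fun c => (l c).tails := by
  have h (m : List α) : m.foldr (fun a t => (a :: t.head?.elim [] fun l => l) :: t) [[]] =
      m.tails := by
    induction m with
    | nil => rfl
    | cons a m ih => rw [List.foldr_cons, ih]; cases m <;> rfl
  refine (foldr (f := fun _ a t => (a :: t.head?.elim [] fun l => l) :: t) hl (const [[]])
    (list_cons (list_cons (by fun_prop) (elim (by fun_prop) (const []) (by fun_prop)))
      (by fun_prop))
    (B := fun c => (encSize (l c) + 1) * (encSize (l c) + 1) + 1)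
    (((hl.bound.add (.const 1)).mul (hl.bound.add (.const 1))).add (.const 1))
    fun c l' hl' => ?_).congr fun c => (h (l c)).symm
  rw [h]
  refine (encSize_list_le (M := encSize (l c)) fun t ht => ?_).trans ?_
  · exact encSize_le_of_suffix (((List.mem_tails t l').1 ht).trans hl')
  · rw [List.length_tails]
    have := hl'.length_le.trans (length_le_encSize (l c))
    gcongr

@[fun_prop]
theorem just_res {j k : γ → ℕ} (hj : PolyTime j) (hk : PolyTime k) :
    PolyTime fun c => Just.res (j c) (k c) := of_cons hj hk fun _ => rfl

end PolyTime

end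

/-! ### Propagation in the order of the variables -/

/-- What a clause says about one variable: `some a` if the literal `x^a` occurs, `none` if the
variable does not occur. A list of these describes a clause; the variable that an entry is about
has the number of entries to the right of it as its position, so the largest variable comes first
and dropping leading entries does not renumber the others. -/
abbrev Code : Type := Option Bool

/-- The literals of a clause, each one with the position of its variable. -/
def lits (e : List Code) : Set (ℕ × Bool) := {l | ∃ r, some l.2 :: r <:+ e ∧ r.length = l.1}

theorem lits_nil : lits [] = ∅ := by
  ext l
  simp [lits]

theorem mem_lits_cons {l : ℕ × Bool} {c : Code} {e : List Code} :
    l ∈ lits (c :: e) ↔ (c = some l.2 ∧ e.length = l.1) ∨ l ∈ lits e := by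
  simp only [lits, Set.mem_ofPred_eq, List.suffix_cons_iff, List.cons.injEq, or_and_right,
    exists_or, and_assoc]
  aesop

theorem lits_none_cons (e : List Code) : lits (none :: e) = lits e := by
  ext l
  simp [mem_lits_cons]

theorem lits_subset_of_suffix {d e : List Code} (h : d <:+ e) : lits d ⊆ lits e :=
  fun _ ⟨r, hr, hl⟩ => ⟨r, hr.trans h, hl⟩

theorem lits_subset_cons (c : Code) (e : List Code) : lits e ⊆ lits (c :: e) :=
  lits_subset_of_suffix (List.suffix_cons c e)

theorem lt_length_of_mem_lits {l : ℕ × Bool} {e : List Code} (h : l ∈ lits e) :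
    l.1 < e.length := by
  obtain ⟨r, hr, hl⟩ := h
  simpa [hl] using hr.length_le

theorem mem_lits_iff_getElem? {l : ℕ × Bool} {e : List Code} :
    l ∈ lits e ↔ e.reverse[l.1]? = some (some l.2) := by
  induction e with
  | nil => simp [lits_nil]
  | cons c e ih =>
    rw [mem_lits_cons, ih, List.reverse_cons]
    rcases lt_trichotomy l.1 e.length with h | h | h
    · simp [List.getElem?_append, h, h.ne']
    · simp [h]
    · simp [h.not_gt, h.ne, h.not_ge]

theorem snd_unique_of_mem_lits {k : ℕ} {a b : Bool} {e : List Code} (ha : (k, a) ∈ lits e)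
    (hb : (k, b) ∈ lits e) : a = b := by
  rw [mem_lits_iff_getElem?] at ha hb
  simpa using ha.symm.trans hb

/-- If the literals in `E` are false, then unit propagation with the clauses in `𝒮` in the order
of the variables shows that the given literal is false. -/
inductive Falsified (𝒮 : Set (List Code)) (E : Set (ℕ × Bool)) : ℕ × Bool → Prop
  | assumption {l : ℕ × Bool} (h : l ∈ E) : Falsified 𝒮 E l
  | propagate {b : Bool} {r : List Code} (h : some (!b) :: r ∈ 𝒮)
      (hr : ∀ l ∈ lits r, Falsified 𝒮 E l) : Falsified 𝒮 E (r.length, b)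

theorem Falsified.trans {𝒮 𝒯 : Set (List Code)} {E G : Set (ℕ × Bool)} {l : ℕ × Bool}
    (h : Falsified 𝒮 E l) (h𝒮 : 𝒮 ⊆ 𝒯) (hE : ∀ m ∈ E, m.1 ≤ l.1 → Falsified 𝒯 G m) :
    Falsified 𝒯 G l := by
  induction h with
  | assumption h => exact hE _ h le_rfl
  | propagate h _ ih =>
    exact .propagate (h𝒮 h) fun l hl => ih l hl fun m hm hml =>
      hE m hm (hml.trans (lt_length_of_mem_lits hl).le)

theorem Falsified.mono {𝒮 𝒯 : Set (List Code)} {E G : Set (ℕ × Bool)} {l : ℕ × Bool}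
    (h : Falsified 𝒮 E l) (h𝒮 : 𝒮 ⊆ 𝒯) (hE : E ⊆ G) : Falsified 𝒯 G l :=
  h.trans h𝒮 fun _ hm _ => .assumption (hE hm)

/-- If the literals in `E` are false, then propagation makes some clause in `𝒮` false of which the
largest literal belongs to `E`. This replaces the derivation of the clause with the literals `E`
itself, which would need weakening. -/
def Covered (𝒮 : Set (List Code)) (E : Set (ℕ × Bool)) : Prop :=
  [] ∈ 𝒮 ∨ ∃ b r, some b :: r ∈ 𝒮 ∧ (r.length, b) ∈ E ∧ ∀ l ∈ lits r, Falsified 𝒮 E l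

theorem Covered.mono {𝒮 𝒯 : Set (List Code)} {E G : Set (ℕ × Bool)} (h : Covered 𝒮 E)
    (h𝒮 : 𝒮 ⊆ 𝒯) (hE : E ⊆ G) : Covered 𝒯 G :=
  h.imp (@h𝒮 _) fun ⟨b, r, hr, hb, hf⟩ => ⟨b, r, h𝒮 hr, hE hb, fun l hl => (hf l hl).mono h𝒮 hE⟩

/-- Propagation from the assumptions `E` falsifies both literals of some variable. -/
def Clash (𝒮 : Set (List Code)) (E : Set (ℕ × Bool)) : Prop :=
  ∃ k, Falsified 𝒮 E (k, true) ∧ Falsified 𝒮 E (k, false)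

theorem Covered.halfOrdered_resolvent {𝒮 : Set (List Code)} {E F G : Set (ℕ × Bool)} {x : ℕ}
    {a : Bool} (hE : Covered 𝒮 E) (hF : Covered 𝒮 F) (hEG : E ⊆ insert (x, a) {l ∈ G | l.1 < x})
    (hFG : F ⊆ insert (x, !a) G) : Covered 𝒮 G ∨ Clash 𝒮 G := by
  rcases hE with hE | ⟨b, r, hr, hb, hf⟩
  · exact .inl (.inl hE)
  have r_le : r.length ≤ x := (hEG hb).elim (fun h => (congrArg Prod.fst h).le) fun h => h.2.le
  -- only assumptions below `x` were used for `r`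
  have hfG : ∀ l ∈ lits r, Falsified 𝒮 G l := fun l hl =>
    (hf l hl).trans subset_rfl fun m hm hml => (hEG hm).elim
      (fun h => absurd (lt_length_of_mem_lits hl) (by subst h; simp only at hml; omega))
      fun h => .assumption h.1
  rcases hEG hb with h | h
  swap
  · exact .inl (.inr ⟨b, r, hr, h.1, hfG⟩)
  obtain ⟨rfl, rfl⟩ := Prod.mk.injEq .. ▸ h
  have not_a : Falsified 𝒮 G (r.length, !b) := .propagate (by rwa [Bool.not_not]) hfG
  rcases hF with hF | ⟨c, s, hs, hc, hg⟩
  · exact .inl (.inl hF)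
  have hgG : ∀ l ∈ lits s, Falsified 𝒮 G l := fun l hl =>
    (hg l hl).trans subset_rfl fun m hm _ => (hFG hm).elim (fun h => h ▸ not_a) .assumption
  rcases hFG hc with h | h
  swap
  · exact .inl (.inr ⟨c, s, hs, h, hgG⟩)
  obtain ⟨hlen, rfl⟩ := Prod.mk.injEq .. ▸ h
  have of_a : Falsified 𝒮 G (r.length, b) := hlen ▸ .propagate hs hgG
  cases b
  · exact .inr ⟨_, not_a, of_a⟩
  · exact .inr ⟨_, of_a, not_a⟩

/-! ### Deriving clauses along a trail -/

/-- A derived clause with its number in the derivation and its justification; the largest variable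
of a nonempty clause is the first entry. -/
structure Entry where
  index : ℕ
  clause : List Code
  just : Just

/-- The clauses derived so far. -/
def clauses (S : List Entry) : Set (List Code) := {u | ∃ E ∈ S, E.clause = u}

theorem clauses_mono {S T : List Entry} (h : S ⊆ T) : clauses S ⊆ clauses T :=
  fun _ ⟨E, hE, hu⟩ => ⟨E, h hE, hu⟩

/-- The state of the propagation, from the largest variable treated so far down to the smallest:
for each variable the falsified literal, together with the clause that forced it if the literal is
not an assumption. -/
abbrev Trail : Type := List (Code × Option Entry)

/-- The falsified literals, in the format of a clause. -/
def values (F : Trail) : List Code := F.map Prod.fst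

theorem length_values (F : Trail) : (values F).length = F.length := List.length_map _

/-- The clause `r` has one entry for each variable of the trail and all its literals are false. -/
def fits (r : List Code) (F : Trail) : Bool :=
  r.length == F.length && (r.zip F).all fun x => x.1.isNone || x.1 == x.2.1

theorem fits_nil_iff {r : List Code} : fits r [] ↔ r = [] := by
  simp +contextual [fits, List.length_eq_zero_iff]

theorem fits_cons_iff {r : List Code} {f : Code × Option Entry} {F : Trail} :
    fits r (f :: F) ↔ ∃ c g, r = c :: g ∧ (c = none ∨ c = f.1) ∧ fits g F := by
  cases r with
  | nil => simp [fits]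
  | cons c g => simp [fits]; tauto

theorem fits_iff {r : List Code} {F : Trail} :
    fits r F ↔ r.length = F.length ∧ lits r ⊆ lits (values F) := by
  induction F generalizing r with
  | nil => simp +contextual [fits_nil_iff, List.length_eq_zero_iff, lits_nil]
  | cons f F ih =>
    cases r with
    | nil => simp [fits_cons_iff]
    | cons c g =>
      simp only [fits_cons_iff, List.cons.injEq, List.length_cons, Nat.add_right_cancel_iff]
      constructor
      · rintro ⟨_, _, ⟨rfl, rfl⟩, hc, hg⟩
        obtain ⟨hgF, hsub⟩ := ih.1 hg
        refine ⟨hgF, fun l hl => ?_⟩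
        change l ∈ lits (f.1 :: values F)
        rw [mem_lits_cons] at hl ⊢
        refine hl.imp (fun ⟨h, h'⟩ => ⟨?_, by rw [length_values, ← hgF, h']⟩) (@hsub l)
        exact hc.elim (fun hc => by simp [hc] at h) fun hc => hc ▸ h
      · rintro ⟨hgF, hsub⟩
        have mem_lits (l) (hl : l ∈ lits (c :: g)) : (f.1 = some l.2 ∧ F.length = l.1) ∨
            l ∈ lits (values F) := by
          simpa [values, mem_lits_cons] using hsub hl
        refine ⟨c, g, ⟨rfl, rfl⟩, ?_, ih.2 ⟨hgF, fun l hl => ?_⟩⟩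
        · rcases c with _ | b
          · exact .inl rfl
          · rcases mem_lits (F.length, b) (mem_lits_cons.2 (.inl ⟨rfl, hgF⟩)) with h | h
            · exact .inr h.1.symm
            · exact absurd (lt_length_of_mem_lits h) (by simp [length_values])
        · refine (mem_lits l (lits_subset_cons c g hl)).resolve_left fun h => ?_
          exact absurd (lt_length_of_mem_lits hl) (by omega)

/-- The disjunction of two clauses that are false under the same trail, given in full length. -/
def merge (r s : List Code) : List Code := List.zipWith Option.or r s

theorem lits_merge {r s : List Code} {F : Trail} (hr : fits r F) (hs : fits s F) :
    lits (merge r s) = lits r ∪ lits s := by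
  induction F generalizing r s with
  | nil => simp [fits_nil_iff.1 hr, fits_nil_iff.1 hs, merge, lits_nil]
  | cons f F ih =>
    obtain ⟨c, g, rfl, hc, hg⟩ := fits_cons_iff.1 hr
    obtain ⟨d, h, rfl, hd, hh⟩ := fits_cons_iff.1 hs
    have hlen : g.length = h.length := (fits_iff.1 hg).1.trans (fits_iff.1 hh).1.symm
    ext l
    have := Set.ext_iff.1 (ih hg hh) l
    simp only [Set.mem_union] at this
    simp only [merge, List.zipWith_cons_cons, Set.mem_union, mem_lits_cons,
      List.length_zipWith, hlen, min_self]
    change _ ∨ l ∈ lits (merge g h) ↔ _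
    rw [this]
    rcases hc with rfl | rfl <;> rcases hd with rfl | rfl <;> simp <;> tauto

theorem fits_merge {r s : List Code} {F : Trail} (hr : fits r F) (hs : fits s F) :
    fits (merge r s) F := by
  have hr' := fits_iff.1 hr
  have hs' := fits_iff.1 hs
  refine fits_iff.2 ⟨?_, lits_merge hr hs ▸ Set.union_subset hr'.2 hs'.2⟩
  rw [merge, List.length_zipWith, hr'.1, hs'.1, min_self]

/-- A clause that falsifies the literal of the next variable with sign `b`. -/
def reason? (S : List Entry) (F : Trail) (b : Bool) : Option Entry :=
  S.find? fun E => E.clause.head?.join == some !b && fits E.clause.tail F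

/-- The clause of `E` consists of a literal `x^(1-b)` and literals below `x` that are false
under `F`, where `x` is the next variable after those of `F`. -/
def IsReason (E : Entry) (F : Trail) (b : Bool) : Prop :=
  E.clause.head? = some (some !b) ∧ fits E.clause.tail F

theorem isReason_iff {E : Entry} {F : Trail} {b : Bool} :
    IsReason E F b ↔ ∃ r, E.clause = some (!b) :: r ∧ fits r F := by
  unfold IsReason
  cases E.clause <;> simp

theorem reason?_eq_some {S : List Entry} {F : Trail} {b : Bool} {E : Entry}
    (h : reason? S F b = some E) : E ∈ S ∧ IsReason E F b :=
  ⟨List.mem_of_find?_eq_some h,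
    by simpa [IsReason, Option.join_eq_some_iff] using List.find?_some h⟩

theorem exists_reason?_eq_some {S : List Entry} {F : Trail} {b : Bool} {E : Entry} (hE : E ∈ S)
    (h : IsReason E F b) : ∃ E', reason? S F b = some E' :=
  Option.isSome_iff_exists.1 (List.find?_isSome.2
    ⟨E, hE, by simpa [IsReason, Option.join_eq_some_iff] using h⟩)

/-- The trail `F` arises by propagation with the clauses of `S` from the assumptions `e`. -/
inductive IsTrail (S : List Entry) : List Code → Trail → Prop
  | nil : IsTrail S [] []
  | unset {e : List Code} {F : Trail} (h : IsTrail S e F) :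
      IsTrail S (none :: e) ((none, none) :: F)
  | assume {e : List Code} {F : Trail} (h : IsTrail S e F) (b : Bool) :
      IsTrail S (some b :: e) ((some b, none) :: F)
  | propagate {e : List Code} {F : Trail} (h : IsTrail S e F) (c : Code) {b : Bool} {E : Entry}
      (hE : E ∈ S) (hb : IsReason E F b) : IsTrail S (c :: e) ((some b, some E) :: F)

theorem IsTrail.length_eq {S : List Entry} {e : List Code} {F : Trail} (h : IsTrail S e F) :
    F.length = e.length := by
  induction h with
  | nil => rfl
  | unset _ ih | assume _ _ ih | propagate _ _ _ _ ih => simp [ih]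

theorem IsTrail.falsified {S : List Entry} {e : List Code} {F : Trail} (h : IsTrail S e F) :
    ∀ l ∈ lits (values F), Falsified (clauses S) (lits e) l := by
  induction h with
  | nil => simp [values, lits_nil]
  | @unset e F _ ih =>
    intro l hl
    rw [lits_none_cons]
    exact ih l (by simpa [values, lits_none_cons] using hl)
  | @assume e F h b ih =>
    intro l hl
    rcases mem_lits_cons.1 hl with ⟨hb, hlen⟩ | hl
    · exact .assumption (mem_lits_cons.2 (.inl ⟨hb, by simpa [h.length_eq] using hlen⟩))
    · exact (ih l hl).mono subset_rfl (lits_subset_cons _ _)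
  | @propagate e F _ c b E hE hb ih =>
    intro l hl
    have ih' (l) (hl : l ∈ lits (values F)) := (ih l hl).mono subset_rfl (lits_subset_cons c e)
    rcases mem_lits_cons.1 hl with ⟨hlb, hlen⟩ | hl
    · obtain ⟨r, hr, hrF⟩ := isReason_iff.1 hb
      obtain ⟨hlenr, hsub⟩ := fits_iff.1 hrF
      obtain rfl : l = (r.length, b) :=
        Prod.ext (by simpa [hlenr] using hlen.symm) (Option.some.inj hlb).symm
      exact .propagate ⟨E, hE, hr⟩ fun m hm => ih' m (hsub hm)
    · exact ih' l hl

/-- Add the clause `u` to the derivation, as its next line. -/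
def push (S : List Entry) (u : List Code) (J : Just) : List Entry := ⟨S.length, u, J⟩ :: S

theorem subset_push (S : List Entry) (u : List Code) (J : Just) : S ⊆ push S u J :=
  List.subset_cons_self _ _

/-- The clause `u`, with justification `J`, is false under the trail. As long as its largest
literal was not assumed, derive it and resolve it with the clause that forced that literal.
The clauses that are derived thus become smaller, until the last one has an assumption as its
largest literal, or is empty. -/
def derive (S : List Entry) (J : Just) : List Code → Trail → List Entry
  | none :: u, _ :: F => derive S J u F
  | some b :: u, (_, some E) :: F =>
    derive (push S (some b :: u) J) (.res S.length E.index) (merge u E.clause.tail) F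
  | u, _ => push S u J

theorem suffix_derive (S : List Entry) (J : Just) (u : List Code) (F : Trail) :
    S <:+ derive S J u F := by
  fun_induction derive with
  | case1 _ _ _ _ _ ih => exact ih
  | case2 _ _ _ _ _ _ _ ih => exact (List.suffix_cons _ _).trans ih
  | case3 => exact List.suffix_cons _ _

theorem covered_derive {S₀ S : List Entry} {e u : List Code} {F : Trail} (h : IsTrail S₀ e F)
    (hS : S₀ ⊆ S) (hu : fits u F) (J : Just) : Covered (clauses (derive S J u F)) (lits e) := by
  induction h generalizing S u J with
  | nil =>
    obtain rfl := fits_nil_iff.1 hu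
    exact .inl ⟨_, List.mem_cons_self, rfl⟩
  | unset _ ih =>
    obtain ⟨c, g, rfl, hc | hc, hg⟩ := fits_cons_iff.1 hu <;> subst hc <;>
    exact (ih hS hg J).mono subset_rfl (lits_subset_cons _ _)
  | @assume e F h b ih =>
    obtain ⟨c, g, rfl, hc | hc, hg⟩ := fits_cons_iff.1 hu <;> subst hc
    · exact (ih hS hg J).mono subset_rfl (lits_subset_cons _ _)
    · obtain ⟨hlen, hsub⟩ := fits_iff.1 hg
      refine .inr ⟨b, g, ⟨_, List.mem_cons_self, rfl⟩, ?_, fun l hl => ?_⟩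
      · exact mem_lits_cons.2 (.inl ⟨rfl, by simp [hlen, h.length_eq]⟩)
      · exact (h.falsified l (hsub hl)).mono
          (clauses_mono (List.Subset.trans hS (subset_push ..))) (lits_subset_cons _ _)
  | @propagate e F _ c b E _ hb ih =>
    obtain ⟨c, g, rfl, hc | hc, hg⟩ := fits_cons_iff.1 hu <;> subst hc
    · exact (ih hS hg J).mono subset_rfl (lits_subset_cons _ _)
    · exact (ih (List.Subset.trans hS (subset_push ..)) (fits_merge hg hb.2) _).mono
        subset_rfl (lits_subset_cons _ _)

/-- The entry of the next variable, for which the clause to be tested has the code `c`. -/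
def assign (S : List Entry) (c : Code) (F : Trail) : Code × Option Entry :=
  (reason? S F true).elim ((reason? S F false).elim (c, none) fun E => (some false, some E))
    fun E => (some true, some E)

/-- The result of propagation from the assumptions `e`. If both literals of a variable are
falsified, only one of them is recorded. -/
def trail (S : List Entry) (e : List Code) : Trail := e.foldr (fun c F => assign S c F :: F) []

theorem isTrail_trail (S : List Entry) (e : List Code) : IsTrail S e (trail S e) := by
  induction e with
  | nil => exact .nil
  | cons c e ih =>
    change IsTrail S _ (assign S c (trail S e) :: trail S e)
    unfold assign
    rcases ht : reason? S (trail S e) true with _ | E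
    · rcases hf : reason? S (trail S e) false with _ | E
      · cases c
        · exact .unset ih
        · exact .assume ih _
      · exact .propagate ih c (reason?_eq_some hf).1 (reason?_eq_some hf).2
    · exact .propagate ih c (reason?_eq_some ht).1 (reason?_eq_some ht).2

theorem length_trail (S : List Entry) (e : List Code) : (trail S e).length = e.length :=
  (isTrail_trail S e).length_eq

theorem trail_suffix {S : List Entry} {d e : List Code} (h : d <:+ e) :
    trail S d <:+ trail S e := by
  obtain ⟨t, rfl⟩ := h
  induction t with
  | nil => exact List.suffix_rfl
  | cons c t ih => exact ih.trans (List.suffix_cons _ _)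

/-- Propagation from `e` never finds reasons for both literals of a variable. -/
def ConflictFree (S : List Entry) (e : List Code) : Prop :=
  ∀ F, F <:+ trail S e → ∀ b E, reason? S F b = some E → reason? S F (!b) = none

theorem fst_assign_eq_some {S : List Entry} {c : Code} {F : Trail} {b : Bool}
    (hb : reason? S F (!b) = none) (h : reason? S F b ≠ none ∨ c = some b) :
    (assign S c F).1 = some b := by
  rcases hr : reason? S F b with _ | E
  · obtain rfl := h.resolve_left (not_not_intro hr)
    cases b <;> simp_all [assign]
  · cases b <;> simp_all [assign]

theorem mem_lits_values_trail {S : List Entry} {c : Code} {b : Bool} {d e : List Code}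
    (hd : c :: d <:+ e) (h : (assign S c (trail S d)).1 = some b) :
    (d.length, b) ∈ lits (values (trail S e)) := by
  refine lits_subset_of_suffix ((trail_suffix hd).map Prod.fst) ?_
  refine mem_lits_cons.2 (.inl ⟨h, ?_⟩)
  exact (length_values _).trans (length_trail S d)

theorem mem_lits_of_suffix {l : ℕ × Bool} {d e : List Code} (h : d <:+ e) (hl : l ∈ lits e)
    (hd : l.1 < d.length) : l ∈ lits d := by
  rw [mem_lits_iff_getElem?] at hl ⊢
  obtain ⟨t, rfl⟩ := h
  rwa [List.reverse_append, List.getElem?_append_left (by simpa using hd)] at hl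

theorem IsReason.covered {S : List Entry} {d e : List Code} {b : Bool} {E : Entry}
    (hd : some b :: d <:+ e) (hE : E ∈ S) (h : IsReason E (trail S d) (!b)) :
    Covered (clauses S) (lits e) := by
  obtain ⟨r, hr, hrF⟩ := isReason_iff.1 h
  obtain ⟨hrd, hsub⟩ := fits_iff.1 hrF
  rw [length_trail] at hrd
  refine .inr ⟨b, r, ⟨E, hE, by simpa using hr⟩, ⟨d, hd, hrd.symm⟩, fun l hl => ?_⟩
  exact ((isTrail_trail S d).falsified l (hsub hl)).mono subset_rfl
    (lits_subset_of_suffix ((List.suffix_cons _ _).trans hd))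

theorem ConflictFree.mem_trail {S : List Entry} {e : List Code} (h : ConflictFree S e)
    (hcov : ¬ Covered (clauses S) (lits e)) (hlen : ∀ E ∈ S, E.clause.length ≤ e.length)
    {l : ℕ × Bool} (hl : Falsified (clauses S) (lits e) l) :
    l ∈ lits (values (trail S e)) := by
  induction hl with
  | @assumption l hl =>
    obtain ⟨k, b⟩ := l
    obtain ⟨d, hd, rfl⟩ := hl
    refine mem_lits_values_trail hd (fst_assign_eq_some ?_ (.inr rfl))
    by_contra! hE
    obtain ⟨E, hE⟩ := Option.ne_none_iff_exists'.1 hE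
    exact hcov ((reason?_eq_some hE).2.covered hd (reason?_eq_some hE).1)
  | @propagate b r hr _ ih =>
    obtain ⟨E, hE, hEr⟩ := hr
    have hre : r.length < e.length := by simpa [hEr] using hlen E hE
    obtain ⟨c, d, hd, hdr⟩ : ∃ c d, c :: d <:+ e ∧ d.length = r.length := by
      have hi : e.length - (r.length + 1) < e.length := by omega
      refine ⟨_, _, List.drop_eq_getElem_cons hi ▸ List.drop_suffix _ e, ?_⟩
      rw [List.length_drop]
      omega
    have hfits : fits r (trail S d) := by
      refine fits_iff.2 ⟨by rw [length_trail, hdr], fun l hl => ?_⟩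
      have hdF := (trail_suffix ((List.suffix_cons c d).trans hd) (S := S)).map Prod.fst
      refine mem_lits_of_suffix hdF (ih l hl) ?_
      rw [length_values, length_trail, hdr]
      exact lt_length_of_mem_lits hl
    obtain ⟨E', hE'⟩ := exists_reason?_eq_some hE (isReason_iff.2 ⟨r, hEr, hfits⟩)
    rw [← hdr]
    refine mem_lits_values_trail hd (fst_assign_eq_some ?_ (.inl (by simp [hE'])))
    exact h _ (trail_suffix ((List.suffix_cons c d).trans hd)) _ _ hE'

/-- Resolve the two reasons for the next variable after those of `F` and continue as in `derive`;
`S` is left unchanged if there are no two reasons. -/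
def refute (S : List Entry) (F : Trail) : List Entry :=
  (reason? S F true).elim S fun A => (reason? S F false).elim S fun B =>
    derive S (.res A.index B.index) (merge A.clause.tail B.clause.tail) F

/-- Make sure that `e` is covered: look for a conflict in the propagation from `e`. -/
def scan (S : List Entry) (e : List Code) : List Entry :=
  ((trail S e).tails.find? fun F => (reason? S F true).isSome && (reason? S F false).isSome).elim S
    (refute S)

theorem ConflictFree.not_clash {S : List Entry} {e : List Code} (h : ConflictFree S e)
    (hcov : ¬ Covered (clauses S) (lits e)) (hlen : ∀ E ∈ S, E.clause.length ≤ e.length) :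
    ¬ Clash (clauses S) (lits e) := fun ⟨_, ht, hf⟩ =>
  absurd (snd_unique_of_mem_lits (h.mem_trail hcov hlen ht) (h.mem_trail hcov hlen hf)) (by simp)

theorem exists_eq_trail_of_suffix {S : List Entry} {e : List Code} {F : Trail}
    (h : F <:+ trail S e) : ∃ d, d <:+ e ∧ F = trail S d := by
  induction e with
  | nil => exact ⟨[], List.suffix_rfl, List.suffix_nil.1 h⟩
  | cons c e ih =>
    rcases List.suffix_cons_iff.1 h with rfl | h
    · exact ⟨_, List.suffix_rfl, rfl⟩
    · obtain ⟨d, hd, rfl⟩ := ih h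
      exact ⟨d, hd.trans (List.suffix_cons _ _), rfl⟩

theorem scan_cases (S : List Entry) (e : List Code) :
    (ConflictFree S e ∧ scan S e = S) ∨
      ∃ d, d <:+ e ∧ ∃ A ∈ S, ∃ B ∈ S, IsReason A (trail S d) true ∧ IsReason B (trail S d) false ∧
        scan S e =
          derive S (.res A.index B.index) (merge A.clause.tail B.clause.tail) (trail S d) := by
  unfold scan
  rcases hF : List.find? _ (trail S e).tails with _ | F
  · refine .inl ⟨fun F hF' b E hE => ?_, rfl⟩
    have := List.find?_eq_none.1 hF F ((List.mem_tails _ _).2 hF')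
    cases b <;> cases ht : reason? S F true <;> simp_all
  · obtain ⟨d, hd, rfl⟩ :=
      exists_eq_trail_of_suffix ((List.mem_tails _ _).1 (List.mem_of_find?_eq_some hF))
    have hAB := List.find?_some hF
    obtain ⟨hA, hB⟩ := Bool.and_eq_true_iff.1 hAB
    obtain ⟨A, hA⟩ := Option.isSome_iff_exists.1 hA
    obtain ⟨B, hB⟩ := Option.isSome_iff_exists.1 hB
    exact .inr ⟨d, hd, A, (reason?_eq_some hA).1, B, (reason?_eq_some hB).1,
      (reason?_eq_some hA).2, (reason?_eq_some hB).2, by simp [refute, hA, hB]⟩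

theorem covered_scan {S : List Entry} {e : List Code} (h : Covered (clauses S) (lits e) ∨
    Clash (clauses S) (lits e)) (hlen : ∀ E ∈ S, E.clause.length ≤ e.length) :
    Covered (clauses (scan S e)) (lits e) := by
  rcases scan_cases S e with ⟨hfree, hS⟩ | ⟨d, hd, A, _, B, _, hA, hB, hS⟩ <;> rw [hS]
  · exact h.elim id fun hclash => by_contra fun hcov => hfree.not_clash hcov hlen hclash
  · exact (covered_derive (isTrail_trail S d) (List.Subset.refl _) (fits_merge hA.2 hB.2) _).mono
      subset_rfl (lits_subset_of_suffix hd)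

/-! ### The derivations as ordered resolution proofs -/

variable {n : ℕ} {π : Equiv.Perm (Fin n)} {τ : Set (Clause n)}

/-- The clause described by `u`, with respect to the order `π`. -/
def clauseOf (π : Equiv.Perm (Fin n)) (u : List Code) : Clause n where
  lits := Finset.univ.filter fun l => u.reverse[(π l.1 : ℕ)]? = some (some l.2)
  consistent i := by simp +contextual

theorem mem_clauseOf {l : Lit n} {u : List Code} :
    l ∈ (clauseOf π u).lits ↔ ((π l.1 : ℕ), l.2) ∈ lits u := by
  simp [clauseOf, mem_lits_iff_getElem?]

/-- The entry of the variable `x_i` in the description of the clause `C`. -/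
def code (C : Clause n) (i : Fin n) : Code :=
  if (i, true) ∈ C.lits then some true else if (i, false) ∈ C.lits then some false else none

theorem code_eq_some_iff {C : Clause n} {i : Fin n} {b : Bool} :
    code C i = some b ↔ (i, b) ∈ C.lits := by
  have := C.consistent i
  cases b <;> grind [code]

/-- The description of the clause `C`, with respect to the order `π`. -/
def sortedCodes (π : Equiv.Perm (Fin n)) (C : Clause n) : List Code :=
  (List.ofFn fun k => code C (π.symm k)).reverse

theorem length_sortedCodes (C : Clause n) : (sortedCodes π C).length = n := by
  simp [sortedCodes]

theorem mem_lits_sortedCodes {C : Clause n} {l : ℕ × Bool} :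
    l ∈ lits (sortedCodes π C) ↔ ∃ i, (i, l.2) ∈ C.lits ∧ (π i : ℕ) = l.1 := by
  obtain ⟨k, b⟩ := l
  rw [mem_lits_iff_getElem?, sortedCodes, List.reverse_reverse, List.getElem?_ofFn]
  constructor
  · intro h
    split at h
    · rename_i hk
      exact ⟨π.symm ⟨k, hk⟩, code_eq_some_iff.1 (Option.some.inj h), by simp⟩
    · simp at h
  · rintro ⟨i, hi, rfl⟩
    simpa [code_eq_some_iff] using hi

theorem clauseOf_sortedCodes (C : Clause n) : clauseOf π (sortedCodes π C) = C := by
  ext l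
  simp [mem_clauseOf, mem_lits_sortedCodes, Fin.val_inj]

theorem Infers.exists_lits_subset {E F G : Clause n} (h : Infers halfOrdered π E F G) :
    ∃ x a, (lits (sortedCodes π E) ⊆ insert (x, a) {l ∈ lits (sortedCodes π G) | l.1 < x} ∧
        lits (sortedCodes π F) ⊆ insert (x, !a) (lits (sortedCodes π G))) ∨
      (lits (sortedCodes π F) ⊆ insert (x, a) {l ∈ lits (sortedCodes π G) | l.1 < x} ∧
        lits (sortedCodes π E) ⊆ insert (x, !a) (lits (sortedCodes π G))) := by
  obtain ⟨i, a, -, -, hlt, hG⟩ := h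
  have antecedent_subset (C : Clause n) (b : Bool) (hC : C.lits.erase (i, b) ⊆ G.lits) :
      lits (sortedCodes π C) ⊆ insert ((π i : ℕ), b) (lits (sortedCodes π G)) ∧
      ((∀ l ∈ C.lits.erase (i, b), π l.1 < π i) → lits (sortedCodes π C) ⊆
        insert ((π i : ℕ), b) {l ∈ lits (sortedCodes π G) | l.1 < π i}) := by
    have mem {l} (hl : l ∈ lits (sortedCodes π C)) : l = ((π i : ℕ), b) ∨
        ∃ m ∈ C.lits.erase (i, b), (m.1, l.2) ∈ G.lits ∧ (π m.1 : ℕ) = l.1 := by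
      obtain ⟨j, hj, hjl⟩ := mem_lits_sortedCodes.1 hl
      by_cases hji : (j, l.2) = (i, b)
      · obtain ⟨rfl, rfl⟩ := Prod.mk.injEq .. ▸ hji
        exact .inl (Prod.ext hjl.symm rfl)
      · have hm := Finset.mem_erase.2 ⟨hji, hj⟩
        exact .inr ⟨_, hm, hC hm, hjl⟩
    refine ⟨fun l hl => (mem hl).imp_right fun ⟨m, _, hm, h⟩ => mem_lits_sortedCodes.2 ⟨_, hm, h⟩,
      fun hlt l hl => (mem hl).imp_right fun ⟨m, hmC, hm, h⟩ =>
        ⟨mem_lits_sortedCodes.2 ⟨_, hm, h⟩, h ▸ hlt m hmC⟩⟩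
  have hE := antecedent_subset E a (hG ▸ Finset.subset_union_left)
  have hF := antecedent_subset F (!a) (hG ▸ Finset.subset_union_right)
  rcases hlt with hlt | hlt
  · exact ⟨_, a, .inl ⟨hE.2 hlt, hF.1⟩⟩
  · exact ⟨_, !a, .inr ⟨hF.2 hlt, by simpa using hE.1⟩⟩

theorem infers_ordered {b : Bool} {r s : List Code} {F : Trail} (hr : fits r F) (hs : fits s F)
    (hn : F.length < n) : Infers ordered π (clauseOf π (some b :: r)) (clauseOf π (some (!b) :: s))
      (clauseOf π (merge r s)) := by
  set i := π.symm ⟨F.length, hn⟩ with hi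
  have hπ (j : Fin n) : F.length = (π j : ℕ) ↔ j = i := by
    rw [hi, Equiv.eq_symm_apply, Fin.ext_iff, eq_comm]
  have mem_clauseOf_cons (b : Bool) (r : List Code) (hr : fits r F) :
      (i, b) ∈ (clauseOf π (some b :: r)).lits ∧
      ∀ l, l ∈ (clauseOf π (some b :: r)).lits.erase (i, b) ↔ ((π l.1 : ℕ), l.2) ∈ lits r := by
    have hlen := (fits_iff.1 hr).1
    refine ⟨mem_clauseOf.2 (mem_lits_cons.2 (.inl ⟨rfl, hlen ▸ (hπ i).2 rfl⟩)), fun l => ?_⟩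
    simp only [Finset.mem_erase, mem_clauseOf, mem_lits_cons, hlen, hπ, Option.some.injEq]
    refine ⟨fun ⟨hne, h⟩ => h.resolve_left fun h => hne (Prod.ext h.2 h.1.symm),
      fun h => ⟨?_, .inr h⟩⟩
    rintro rfl
    exact absurd (lt_length_of_mem_lits h) (by simp [hlen, ← (hπ i).2 rfl])
  refine ⟨i, b, (mem_clauseOf_cons b r hr).1, (mem_clauseOf_cons _ s hs).1, fun l hl => ?_, ?_⟩
  · have hl : ((π l.1 : ℕ), l.2) ∈ lits (merge r s) := by
      rwa [Finset.mem_union, (mem_clauseOf_cons _ _ hr).2, (mem_clauseOf_cons _ _ hs).2,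
        ← Set.mem_union, ← lits_merge hr hs] at hl
    have := lt_length_of_mem_lits hl
    rwa [(fits_iff.1 (fits_merge hr hs)).1, (hπ i).2 rfl] at this
  · ext l
    rw [mem_clauseOf, lits_merge hr hs, Finset.mem_union, (mem_clauseOf_cons _ _ hr).2,
      (mem_clauseOf_cons _ _ hs).2]
    rfl

theorem lineOK_append_iff {R : System} {P Q : Proof n} {t : ℕ} {L : Line n} (ht : t ≤ P.length) :
    LineOK R π τ (P ++ Q) t L ↔ LineOK R π τ P t L := by
  unfold LineOK
  split
  · rfl
  · refine and_congr_right fun hj => and_congr_right fun hk => ?_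
    rw [List.getElem?_append_left (hj.trans_le ht), List.getElem?_append_left (hk.trans_le ht)]

theorem isProof_concat_iff {R : System} {P : Proof n} {L : Line n} :
    IsProof R π τ (P ++ [L]) ↔ IsProof R π τ P ∧ LineOK R π τ P P.length L := by
  constructor
  · refine fun h => ⟨fun t M hM => ?_, ?_⟩
    · have ht := (List.getElem?_eq_some_iff.1 hM).1
      exact (lineOK_append_iff ht.le).1 (h t M (List.getElem?_append_left ht ▸ hM))
    · exact (lineOK_append_iff le_rfl).1 (h P.length L List.getElem?_concat_length)
  · rintro ⟨h, hL⟩ t M hM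
    rcases lt_trichotomy t P.length with ht | rfl | ht
    · exact (lineOK_append_iff ht.le).2 (h t M (List.getElem?_append_left ht ▸ hM))
    · obtain rfl : L = M := by simpa using hM
      exact (lineOK_append_iff le_rfl).2 hL
    · simp [ht] at hM

/-- The line of a proof that the entry `E` stands for. -/
def toLine (π : Equiv.Perm (Fin n)) (E : Entry) : Line n := ⟨clauseOf π E.clause, E.just⟩

/-- The derivation that is recorded in `S`, where the last line comes first. -/
def toProof (π : Equiv.Perm (Fin n)) (S : List Entry) : Proof n := (S.map (toLine π)).reverse

theorem length_toProof (S : List Entry) : (toProof π S).length = S.length := by simp [toProof]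

theorem toProof_push (S : List Entry) (u : List Code) (J : Just) :
    toProof π (push S u J) = toProof π S ++ [⟨clauseOf π u, J⟩] := by
  simp [toProof, push, toLine]

/-- `S` records an ordered resolution proof from `τ` over `n` variables, with the entries numbered
as the lines of that proof. -/
structure Valid (π : Equiv.Perm (Fin n)) (τ : Set (Clause n)) (S : List Entry) : Prop where
  isProof : IsProof ordered π τ (toProof π S)
  getElem?_index : ∀ E ∈ S, (toProof π S)[E.index]? = some (toLine π E)
  length_le : ∀ E ∈ S, E.clause.length ≤ n

theorem Valid.nil : Valid π τ [] where
  isProof := by simp [toProof, IsProof]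
  getElem?_index := by simp
  length_le := by simp

/-- `J` justifies `u` as the next line of an ordered resolution proof after the lines in `S`. -/
def Justifies (π : Equiv.Perm (Fin n)) (τ : Set (Clause n)) (S : List Entry) (J : Just)
    (u : List Code) : Prop :=
  LineOK ordered π τ (toProof π S) S.length ⟨clauseOf π u, J⟩

theorem Valid.push {S : List Entry} {J : Just} {u : List Code} (h : Valid π τ S)
    (hJ : Justifies π τ S J u) (hu : u.length ≤ n) : Valid π τ (push S u J) where
  isProof := by
    rw [toProof_push, isProof_concat_iff, length_toProof]
    exact ⟨h.isProof, hJ⟩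
  getElem?_index E hE := by
    rw [toProof_push]
    rcases List.mem_cons.1 hE with rfl | hE
    · rw [← length_toProof (π := π) S, List.getElem?_concat_length]
      rfl
    · have := h.getElem?_index E hE
      grind
  length_le E hE := (List.mem_cons.1 hE).elim (fun h => h ▸ hu) (h.length_le E)

theorem Valid.justifies_res {S : List Entry} {A B : Entry} {b : Bool} {r s : List Code} {F : Trail}
    (h : Valid π τ S) (hA : A ∈ S) (hB : B ∈ S) (hAr : A.clause = some b :: r)
    (hBs : B.clause = some (!b) :: s) (hr : fits r F) (hs : fits s F) :
    Justifies π τ S (.res A.index B.index) (merge r s) := by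
  have index_lt {E : Entry} (hE : E ∈ S) : E.index < S.length := by
    simpa [length_toProof] using (List.getElem?_eq_some_iff.1 (h.getElem?_index E hE)).1
  refine ⟨index_lt hA, index_lt hB, _, _, h.getElem?_index A hA, h.getElem?_index B hB, ?_⟩
  simp only [toLine, hAr, hBs]
  refine infers_ordered hr hs ?_
  rw [← (fits_iff.1 hr).1]
  simpa [hAr] using h.length_le A hA

theorem Justifies.of_none_cons {S : List Entry} {J : Just} {u : List Code}
    (h : Justifies π τ S J (none :: u)) : Justifies π τ S J u := by
  have : clauseOf π (none :: u) = clauseOf π u := by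
    ext l
    simp [mem_clauseOf, lits_none_cons]
  rwa [Justifies, ← this]

theorem Valid.derive {S₀ S : List Entry} {e u : List Code} {F : Trail} {J : Just}
    (ht : IsTrail S₀ e F) (h : Valid π τ S) (hS : S₀ ⊆ S) (hu : fits u F) (hF : F.length ≤ n)
    (hJ : Justifies π τ S J u) : Valid π τ (derive S J u F) := by
  have hun : u.length ≤ n := (fits_iff.1 hu).1.trans_le hF
  induction ht generalizing S u J with
  | nil =>
    obtain rfl := fits_nil_iff.1 hu
    exact h.push hJ hun
  | unset _ ih =>
    obtain ⟨c, g, rfl, hc | hc, hg⟩ := fits_cons_iff.1 hu <;> subst hc <;>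
    exact ih h hS hg (Nat.le_of_succ_le hF) hJ.of_none_cons (Nat.le_of_succ_le hun)
  | assume _ _ ih =>
    obtain ⟨c, g, rfl, hc | hc, hg⟩ := fits_cons_iff.1 hu <;> subst hc
    · exact ih h hS hg (Nat.le_of_succ_le hF) hJ.of_none_cons (Nat.le_of_succ_le hun)
    · exact h.push hJ hun
  | @propagate _ F _ _ b E hE hb ih =>
    obtain ⟨c, g, rfl, hc | hc, hg⟩ := fits_cons_iff.1 hu <;> subst hc
    · exact ih h hS hg (Nat.le_of_succ_le hF) hJ.of_none_cons (Nat.le_of_succ_le hun)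
    · obtain ⟨r, hr, hrF⟩ := isReason_iff.1 hb
      have hgE : fits (merge g E.clause.tail) F := fits_merge hg hb.2
      refine ih (h.push hJ hun) (List.Subset.trans hS (subset_push ..)) hgE
        (Nat.le_of_succ_le hF) ?_ ((fits_iff.1 hgE).1.trans_le (Nat.le_of_succ_le hF))
      rw [hr, List.tail_cons]
      exact (h.push hJ hun).justifies_res (A := ⟨S.length, some b :: g, J⟩) List.mem_cons_self
        (List.mem_cons_of_mem _ (hS hE)) rfl hr hg hrF

theorem length_derive_le (S : List Entry) (J : Just) (u : List Code) (F : Trail) :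
    (derive S J u F).length ≤ S.length + 1 + F.countP (·.2.isSome) := by
  fun_induction derive with
  | case1 S J u f F ih => exact ih.trans (by rw [List.countP_cons]; omega)
  | case2 S J b u a E F ih =>
    have push_length : (push S (some b :: u) J).length = S.length + 1 := rfl
    rw [List.countP_cons_of_pos rfl]
    omega
  | case3 => simp [push]

/-- The sizes of the clauses of `S` when they are filled up with all variables below their
largest one, that is, the positions of these largest variables, shifted by one. -/
def tops (S : List Entry) : Finset ℕ := (S.map (·.clause.length)).toFinset

theorem mem_tops {S : List Entry} {k : ℕ} : k ∈ tops S ↔ ∃ E ∈ S, E.clause.length = k := by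
  simp [tops]

theorem tops_push (S : List Entry) (u : List Code) (J : Just) :
    tops (push S u J) = insert u.length (tops S) := by
  simp [tops, push]

/-- Different clauses that forced a literal have different largest variables. -/
theorem IsTrail.countP_le_card_tops {S : List Entry} {e : List Code} {F : Trail}
    (h : IsTrail S e F) : F.countP (·.2.isSome) ≤ (tops S).card := by
  suffices F.countP (·.2.isSome) ≤ ((tops S).filter (· ≤ F.length)).card from
    this.trans (Finset.card_filter_le _ _)
  induction h with
  | nil => simp
  | unset _ ih | assume _ _ ih =>
    rw [List.countP_cons_of_neg (by simp)]
    exact ih.trans (Finset.card_le_card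
      (Finset.monotone_filter_right _ fun _ _ hk => hk.trans (Nat.le_succ _)))
  | @propagate _ F _ _ b E hE hb ih =>
    obtain ⟨r, hr, hrF⟩ := isReason_iff.1 hb
    have mem : F.length + 1 ∈ tops S :=
      mem_tops.2 ⟨E, hE, by rw [hr, List.length_cons, (fits_iff.1 hrF).1]⟩
    rw [List.countP_cons_of_pos rfl]
    refine Nat.succ_le_of_lt (ih.trans_lt (Finset.card_lt_card ?_))
    refine ⟨Finset.monotone_filter_right _ fun _ _ hk => hk.trans (Nat.le_succ _), fun hsub => ?_⟩
    have := hsub (Finset.mem_filter.2 ⟨mem, le_rfl⟩)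
    simp at this

theorem card_tops_derive_le {S₀ S : List Entry} {e u : List Code} {F : Trail} (h : IsTrail S₀ e F)
    (hS : S₀ ⊆ S) (hu : fits u F) (J : Just) :
    (tops (derive S J u F)).card ≤ (tops S).card + 1 := by
  have card_push (T : List Entry) (v : List Code) (K : Just) :
      (tops (push T v K)).card ≤ (tops T).card + 1 := by
    rw [tops_push]
    exact Finset.card_insert_le _ _
  induction h generalizing S u J with
  | nil =>
    obtain rfl := fits_nil_iff.1 hu
    exact card_push ..
  | unset _ ih =>
    obtain ⟨c, g, rfl, hc | hc, hg⟩ := fits_cons_iff.1 hu <;> subst hc <;> exact ih hS hg J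
  | assume _ _ ih =>
    obtain ⟨c, g, rfl, hc | hc, hg⟩ := fits_cons_iff.1 hu <;> subst hc
    · exact ih hS hg J
    · exact card_push ..
  | @propagate _ F _ _ b E hE hb ih =>
    obtain ⟨c, g, rfl, hc | hc, hg⟩ := fits_cons_iff.1 hu <;> subst hc
    · exact ih hS hg J
    · obtain ⟨r, hr, hrF⟩ := isReason_iff.1 hb
      -- the intermediate clause has the same largest variable as the clause of `E`
      have tops_eq : tops (push S (some b :: g) J) = tops S := by
        rw [tops_push, Finset.insert_eq_self]
        exact mem_tops.2 ⟨E, hS hE, by simp [hr, (fits_iff.1 hrF).1, (fits_iff.1 hg).1]⟩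
      exact (ih (List.Subset.trans hS (subset_push ..)) (fits_merge hg hb.2) _).trans
        (congrArg (Finset.card · + 1) tops_eq).le

theorem isTrail_assumptions (S : List Entry) (e : List Code) :
    IsTrail S e (e.map fun c => (c, none)) := by
  induction e with
  | nil => exact .nil
  | cons c e ih =>
    cases c with
    | none => exact .unset ih
    | some b => exact .assume ih b

theorem fits_assumptions (e : List Code) : fits e (e.map fun c => (c, none)) := by
  refine fits_iff.2 ⟨(List.length_map _).symm, ?_⟩
  simp [values, Function.comp_def]

/-- Extend the derivation `S` so that it covers the next line of the given proof. -/
def process (S : List Entry) (L : List Code × Just) : List Entry :=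
  match L.2 with
  | .ax => derive S .ax L.1 (L.1.map fun c => (c, none))
  | .res _ _ => scan S L.1

/-- The ordered derivation that simulates the half-ordered proof `Γ`. -/
def simulate (Γ : List (List Code × Just)) : List Entry := Γ.foldl process []

theorem suffix_process (S : List Entry) (L : List Code × Just) : S <:+ process S L := by
  unfold process
  split
  · exact suffix_derive ..
  · rcases scan_cases S L.1 with ⟨-, hS⟩ | ⟨d, -, A, -, B, -, -, -, hS⟩ <;> rw [hS]
    exact suffix_derive ..

theorem card_tops_process_le (S : List Entry) (L : List Code × Just) :
    (tops (process S L)).card ≤ (tops S).card + 1 := by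
  unfold process
  split
  · exact card_tops_derive_le (isTrail_assumptions S _) (List.Subset.refl _) (fits_assumptions _) _
  · rcases scan_cases S L.1 with ⟨-, hS⟩ | ⟨d, -, A, -, B, -, hA, hB, hS⟩ <;> rw [hS]
    · exact Nat.le_succ _
    · exact card_tops_derive_le (isTrail_trail S d) (List.Subset.refl _) (fits_merge hA.2 hB.2) _

theorem length_process_le {S : List Entry} {L : List Code × Just}
    (hlen : ∀ E ∈ S, E.clause.length ≤ L.1.length) :
    (process S L).length ≤ S.length + 1 + min (tops S).card (L.1.length - 1) := by
  unfold process
  split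
  · refine (length_derive_le ..).trans ?_
    simp [List.countP_eq_zero.2]
  · rcases scan_cases S L.1 with ⟨-, hS⟩ | ⟨d, -, A, hAS, B, -, hA, -, hS⟩ <;> rw [hS]
    · omega
    obtain ⟨r, hr, hrF⟩ := isReason_iff.1 hA
    have hd : (trail S d).length + 1 ≤ L.1.length := by
      simpa [hr, (fits_iff.1 hrF).1] using hlen A hAS
    refine (length_derive_le ..).trans (Nat.add_le_add_left (le_min ?_ ?_) _)
    · exact (isTrail_trail S d).countP_le_card_tops
    · exact List.countP_le_length.trans (Nat.le_sub_one_of_lt hd)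

/-- The line `L`, with its clause described with respect to the order `π`. -/
def sortedLine (π : Equiv.Perm (Fin n)) (L : Line n) : List Code × Just :=
  (sortedCodes π L.clause, L.just)

theorem Valid.process {S : List Entry} {L : Line n} (h : Valid π τ S)
    (hL : L.just = .ax → L.clause ∈ τ) : Valid π τ (process S (sortedLine π L)) := by
  have length_le {e : List Code} (he : e <:+ sortedCodes π L.clause) : e.length ≤ n :=
    he.length_le.trans (length_sortedCodes _).le
  unfold OrdRes.process sortedLine
  split
  · rename_i hax
    refine h.derive (isTrail_assumptions S _) (List.Subset.refl _) (fits_assumptions _) ?_ ?_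
    · simpa using length_le List.suffix_rfl
    · simpa [Justifies, LineOK, clauseOf_sortedCodes] using hL hax
  · rcases scan_cases S (sortedCodes π L.clause) with
      ⟨-, hS⟩ | ⟨d, hd, A, hAS, B, hBS, hA, hB, hS⟩ <;> rw [hS]
    · exact h
    obtain ⟨r, hr, hrF⟩ := isReason_iff.1 hA
    obtain ⟨s, hs, hsF⟩ := isReason_iff.1 hB
    refine h.derive (isTrail_trail S d) (List.Subset.refl _) (fits_merge hA.2 hB.2) ?_ ?_
    · exact (length_trail S d).trans_le (length_le hd)
    · rw [hr, hs]
      exact h.justifies_res (b := false) hAS hBS hr hs hrF hsF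

theorem covered_process_ax (S : List Entry) (e : List Code) :
    Covered (clauses (process S (e, .ax))) (lits e) :=
  covered_derive (isTrail_assumptions S e) (List.Subset.refl _) (fits_assumptions e) _

/-- What the simulation of the lines `Γ` has achieved with the derivation `S`. -/
structure Simulates (π : Equiv.Perm (Fin n)) (τ : Set (Clause n)) (Γ : Proof n)
    (S : List Entry) : Prop where
  valid : Valid π τ S
  covered : ∀ L ∈ Γ, Covered (clauses S) (lits (sortedCodes π L.clause))
  card_tops_le : (tops S).card ≤ Γ.length
  length_le_mul : 1 ≤ n → S.length ≤ n * Γ.length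
  length_le_sq : S.length ≤ Γ.length * (Γ.length + 1)

theorem Simulates.covered_process {Γ : Proof n} {S : List Entry} (h : Simulates π τ Γ S)
    {L : Line n} (hL : LineOK halfOrdered π τ Γ Γ.length L) :
    Covered (clauses (process S (sortedLine π L))) (lits (sortedCodes π L.clause)) := by
  obtain ⟨C, J⟩ := L
  cases J with
  | ax => exact covered_process_ax S _
  | res j k =>
    obtain ⟨-, -, A, B, hA, hB, hAB⟩ := hL
    have hA := h.covered A (List.mem_of_getElem? hA)
    have hB := h.covered B (List.mem_of_getElem? hB)
    refine covered_scan ?_ fun E hE => (h.valid.length_le E hE).trans (length_sortedCodes _).ge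
    obtain ⟨x, a, ⟨hAC, hBC⟩ | ⟨hBC, hAC⟩⟩ := hAB.exists_lits_subset
    · exact hA.halfOrdered_resolvent hB hAC hBC
    · exact hB.halfOrdered_resolvent hA hBC hAC

theorem Simulates.concat {Γ : Proof n} {S : List Entry} (h : Simulates π τ Γ S) {L : Line n}
    (hL : LineOK halfOrdered π τ Γ Γ.length L) :
    Simulates π τ (Γ ++ [L]) (process S (sortedLine π L)) := by
  have length_le : (process S (sortedLine π L)).length ≤
      S.length + 1 + min (tops S).card (n - 1) := by
    simpa only [sortedLine, length_sortedCodes] using length_process_le (L := sortedLine π L)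
      fun E hE => (h.valid.length_le E hE).trans (length_sortedCodes _).ge
  have hΓ := h.card_tops_le
  refine ⟨h.valid.process fun hax => ?_, fun M hM => ?_, ?_, fun hn => ?_, ?_⟩
  · simpa only [LineOK, hax] using hL
  · rcases List.mem_append.1 hM with hM | hM
    · exact (h.covered M hM).mono (clauses_mono (suffix_process S _).subset) subset_rfl
    · obtain rfl := List.mem_singleton.1 hM
      exact h.covered_process hL
  · rw [List.length_append, List.length_singleton]
    exact (card_tops_process_le S _).trans (Nat.succ_le_succ hΓ)
  · calc _ ≤ S.length + n := by omega
      _ ≤ n * Γ.length + n := Nat.add_le_add_right (h.length_le_mul hn) n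
      _ = n * (Γ ++ [L]).length := by rw [List.length_append, List.length_singleton, Nat.mul_succ]
  · rw [List.length_append, List.length_singleton]
    nlinarith [h.length_le_sq, min_le_left (tops S).card (n - 1)]

theorem simulates_simulate {Γ : Proof n} (h : IsProof halfOrdered π τ Γ) :
    Simulates π τ Γ (simulate (Γ.map (sortedLine π))) := by
  induction Γ using List.reverseRecOn with
  | nil => exact ⟨.nil, by simp, by simp [simulate, tops], by simp [simulate], by simp [simulate]⟩
  | append_singleton Γ L ih =>
    rw [simulate, List.map_append, List.foldl_append]
    exact (ih (isProof_concat_iff.1 h).1).concat (isProof_concat_iff.1 h).2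

theorem Simulates.refutes {Γ : Proof n} {S : List Entry} (h : Simulates π τ Γ S)
    (hΓ : ∃ L ∈ Γ, L.clause.lits = ∅) : Refutes ordered π τ (toProof π S) := by
  obtain ⟨L, hL, hLe⟩ := hΓ
  refine ⟨h.valid.isProof, ?_⟩
  have lits_eq : lits (sortedCodes π L.clause) = ∅ := by
    ext l
    simp [mem_lits_sortedCodes, hLe]
  rcases h.covered L hL with ⟨E, hE, hEe⟩ | ⟨b, r, -, hb, -⟩
  · refine ⟨toLine π E, by simpa [toProof] using ⟨E, hE, rfl⟩, ?_⟩
    ext l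
    simp [toLine, hEe, mem_clauseOf, lits_nil]
  · simp [lits_eq] at hb

/-! ### The simulation in polynomial time -/

instance : Enc Entry := ⟨fun E => enc (E.index, E.clause, E.just)⟩

theorem encSize_entry (E : Entry) :
    encSize E = encSize E.index + (encSize E.clause + encSize E.just + 1) + 1 := rfl

theorem encSize_just_res (j k : ℕ) : encSize (Just.res j k) = encSize j + encSize k + 1 := rfl

theorem encSize_code_le (c : Code) : encSize c ≤ 5 := by
  obtain _ | _ | _ := c <;> decide

theorem encSize_codes_le (u : List Code) : encSize u ≤ 6 * u.length + 1 := by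
  rw [Nat.mul_comm]
  exact encSize_list_le fun c _ => encSize_code_le c

namespace PolyTime

variable {γ : Type} [Enc γ]

section

variable {E : γ → Entry}

@[fun_prop]
theorem entry_index (hE : PolyTime E) : PolyTime fun c => (E c).index := of_head hE fun _ => rfl

@[fun_prop]
theorem entry_clause (hE : PolyTime E) : PolyTime fun c => (E c).clause :=
  of_head (g := fun c => ((E c).clause, (E c).just)) (of_tail hE fun _ => rfl) fun _ => rfl

@[fun_prop]
theorem entry_just (hE : PolyTime E) : PolyTime fun c => (E c).just :=
  of_tail (g := fun c => ((E c).clause, (E c).just)) (of_tail hE fun _ => rfl) fun _ => rfl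

end

variable {S : γ → List Entry} {u e : γ → List Code} {F : γ → Trail} {J : γ → Just}

@[fun_prop]
theorem push (hS : PolyTime S) (hu : PolyTime u) (hJ : PolyTime J) :
    PolyTime fun c => push (S c) (u c) (J c) :=
  list_cons (of_cons (hS.list_length) (hu.pair hJ) fun _ => rfl) hS

@[fun_prop]
theorem merge (hu : PolyTime u) (he : PolyTime e) : PolyTime fun c => merge (u c) (e c) := by
  unfold OrdRes.merge
  fun_prop

@[fun_prop]
theorem fits (hu : PolyTime u) (hF : PolyTime F) : PolyTime fun c => fits (u c) (F c) := by
  unfold OrdRes.fits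
  fun_prop

@[fun_prop]
theorem reason? {b : γ → Bool} (hS : PolyTime S) (hF : PolyTime F) (hb : PolyTime b) :
    PolyTime fun c => reason? (S c) (F c) (b c) := by
  unfold OrdRes.reason?
  fun_prop

@[fun_prop]
theorem assign {a : γ → Code} (hS : PolyTime S) (ha : PolyTime a) (hF : PolyTime F) :
    PolyTime fun c => assign (S c) (a c) (F c) := by
  unfold OrdRes.assign
  fun_prop

end PolyTime

theorem enc_just_eq_nil {J : Just} : enc J = .nil ↔ J = .ax := by
  cases J <;> simp [enc, encJust]

theorem encSize_trail_le (S : List Entry) (e : List Code) :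
    encSize (trail S e) ≤ e.length * (encSize S + 14) + 1 := by
  rw [← length_trail S e]
  refine encSize_list_le fun x hx => ?_
  obtain ⟨c, d, rfl⟩ : ∃ c d, x = assign S c (trail S d) := by
    induction e with
    | nil => cases hx
    | cons c e ih => exact (List.mem_cons.1 hx).elim (fun h => ⟨c, e, h⟩) ih
  have reason_le (b E) (h : reason? S (trail S d) b = some E) :
      encSize (some b, some E) ≤ encSize S + 8 := by
    have := encSize_le_of_mem (reason?_eq_some h).1
    have := encSize_code_le (some b)
    rw [encSize_pair, encSize_some E]
    omega
  unfold assign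
  rcases ht : reason? S (trail S d) true with _ | E
  · rcases hf : reason? S (trail S d) false with _ | E
    · have := encSize_code_le c
      simp only [Option.elim_none, encSize_pair, encSize_none]
      omega
    · exact (reason_le _ _ hf).trans (by omega)
  · exact (reason_le _ _ ht).trans (by omega)

theorem encSize_push (S : List Entry) (u : List Code) (J : Just) :
    encSize (push S u J) = encSize S + encSize u + encSize J + 2 * S.length + 4 := by
  simp only [push, encSize_cons, encSize_entry, encSize_nat]
  omega

theorem encSize_derive_le {N : ℕ} {S : List Entry} {J : Just} {u : List Code} {F : Trail}
    (hS : S.length + F.length ≤ N) (hu : u.length ≤ N) (hF : ∀ f ∈ F, encSize f ≤ N)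
    (hJ : encSize J ≤ 3 * N + 2) :
    encSize (derive S J u F) ≤ encSize S + (F.length + 1) * (11 * N + 7) := by
  have push_le {S : List Entry} {J : Just} {u : List Code} (hS : S.length ≤ N)
      (hu : u.length ≤ N) (hJ : encSize J ≤ 3 * N + 2) :
      encSize (push S u J) ≤ encSize S + (11 * N + 7) := by
    have := encSize_codes_le u
    rw [encSize_push]
    omega
  fun_induction derive with
  | case1 S J u f F ih =>
    rw [List.forall_mem_cons] at hF
    simp only [List.length_cons] at hS hu ⊢
    exact (ih (by omega) (by omega) hF.2 hJ).trans (by gcongr; omega)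
  | case2 S J b u c E F ih =>
    rw [List.forall_mem_cons] at hF
    simp only [List.length_cons] at hS hu ⊢
    have hE : encSize (some E) < encSize (c, some E) := by rw [encSize_pair]; omega
    rw [encSize_some, encSize_entry] at hE
    have hderive := ih (by simp only [push, List.length_cons]; omega)
      (by rw [merge, List.length_zipWith]; omega) hF.2
      (by rw [encSize_just_res, encSize_nat]; omega)
    have hpush := push_le (S := S) (u := some b :: u) (by omega) hu hJ
    linarith
  | case3 F =>
    refine (push_le (by omega) hu hJ).trans (Nat.add_le_add_left ?_ _)
    exact Nat.le_mul_of_pos_left _ F.length.succ_pos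

/-- The state of a loop that computes `derive`: the derivation, together with the next clause and
its justification, unless the loop is finished. -/
abbrev DeriveState : Type := List Entry × Option (Just × List Code)

/-- The derivation when the loop ends after the last variable: a clause that is left is derived
without further resolution. -/
def DeriveState.finish (s : DeriveState) : List Entry := s.2.elim s.1 fun x => push s.1 x.2 x.1

/-- One iteration of the loop, for the variable with the entry `f` of the trail. -/
def DeriveState.step (s : DeriveState) (f : Code × Option Entry) : DeriveState :=
  s.2.elim s fun x => x.2.head?.elim (push s.1 x.2 x.1, none) fun c =>
    c.elim (s.1, some (x.1, x.2.tail)) fun _ => f.2.elim (push s.1 x.2 x.1, none) fun E =>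
      (push s.1 x.2 x.1, some (.res s.1.length E.index, merge x.2.tail E.clause.tail))

theorem DeriveState.finish_foldl_none (S : List Entry) (F : Trail) :
    (F.foldl step (S, none)).finish = S := by
  induction F with
  | nil => rfl
  | cons _ _ ih => exact ih

theorem DeriveState.finish_foldl_some (S : List Entry) (J : Just) (u : List Code) (F : Trail) :
    (F.foldl step (S, some (J, u))).finish = derive S J u F := by
  fun_induction derive with
  | case1 _ _ _ _ _ ih => exact ih
  | case2 _ _ _ _ _ _ _ ih => exact ih
  | case3 F S J u h₁ h₂ =>
    rcases F with _ | ⟨⟨c, E⟩, F⟩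
    · rfl
    · rcases u with _ | ⟨_ | b, u⟩
      · exact finish_foldl_none ..
      · exact absurd rfl (h₁ _ _ _ rfl)
      · cases E with
        | none => exact finish_foldl_none ..
        | some E => exact absurd rfl (h₂ _ _ _ _ _ rfl)

theorem DeriveState.encSize_le (s : DeriveState) : encSize s ≤ encSize s.finish + 3 := by
  obtain ⟨S, _ | ⟨J, u⟩⟩ := s
  · rw [encSize_pair, encSize_none]
    exact Nat.le_succ _
  · change _ ≤ encSize (OrdRes.push S u J) + 3
    rw [encSize_push, encSize_pair, encSize_some, encSize_pair]
    omega

namespace PolyTime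

variable {γ : Type} [Enc γ] {S : γ → List Entry} {u e : γ → List Code} {F : γ → Trail}
  {J : γ → Just}

@[fun_prop]
theorem trail (hS : PolyTime S) (he : PolyTime e) : PolyTime fun c => trail (S c) (e c) := by
  refine foldr (f := fun c a F => OrdRes.assign (S c) a F :: F) he (const [])
    (list_cons (assign (hS.comp (by fun_prop)) (by fun_prop) (by fun_prop)) (by fun_prop))
    ((he.bound.mul (hS.bound.add (.const 14))).add (.const 1)) fun c d hd => ?_
  have hlen := hd.length_le.trans (length_le_encSize (e c))
  exact (encSize_trail_le (S c) d).trans (by gcongr)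

theorem deriveState_finish {s : γ → DeriveState} (hs : PolyTime s) :
    PolyTime fun c => (s c).finish := by
  unfold DeriveState.finish
  fun_prop

theorem deriveState_step : PolyTime fun x : DeriveState × Code × Option Entry => x.1.step x.2 := by
  unfold DeriveState.step
  refine elim (by fun_prop) (by fun_prop) (elim (by fun_prop) (by fun_prop) (elim (by fun_prop)
    (by fun_prop) (elim ?_ ?_ ?_))) <;> fun_prop

@[fun_prop]
theorem derive (hS : PolyTime S) (hJ : PolyTime J) (hu : PolyTime u) (hF : PolyTime F) :
    PolyTime fun c => derive (S c) (J c) (u c) (F c) := by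
  let N : γ → ℕ := fun c => encSize (S c) + encSize (J c) + encSize (u c) + encSize (F c)
  have hN : PolyBound N := ((hS.bound.add hJ.bound).add hu.bound).add hF.bound
  refine (deriveState_finish (foldl (s := fun c => (S c, Option.some (J c, u c)))
    (f := fun _ => DeriveState.step) hF (by fun_prop)
    (deriveState_step.comp (f := fun x : γ × DeriveState × Code × Option Entry => x.2)
      (by fun_prop))
    (B := fun c => N c + (N c + 1) * (11 * N c + 7) + 3)
    ((hN.add ((hN.add (.const 1)).mul (((PolyBound.const 11).mul hN).add (.const 7)))).add
      (.const 3)) fun c F' hF' => ?_)).congr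
    fun c => (DeriveState.finish_foldl_some ..).symm
  refine (DeriveState.encSize_le _).trans (Nat.add_le_add_right ?_ 3)
  rw [DeriveState.finish_foldl_some]
  have hS_len := length_le_encSize (S c)
  have hu_len := length_le_encSize (u c)
  have hF_len := hF'.length_le.trans (length_le_encSize (F c))
  refine (encSize_derive_le (N := N c) ?_ ?_ (fun f hf => ?_) ?_).trans ?_
  · dsimp only [N]; omega
  · dsimp only [N]; omega
  · have := encSize_le_of_mem (hF'.subset hf)
    dsimp only [N]; omega
  · dsimp only [N]; omega
  · gcongr <;> dsimp only [N] <;> omega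

@[fun_prop]
theorem refute (hS : PolyTime S) (hF : PolyTime F) : PolyTime fun c => refute (S c) (F c) := by
  unfold OrdRes.refute
  exact elim (by fun_prop) hS (elim (by fun_prop) (by fun_prop) (by fun_prop))

@[fun_prop]
theorem scan (hS : PolyTime S) (he : PolyTime e) : PolyTime fun c => scan (S c) (e c) := by
  unfold OrdRes.scan
  exact elim (list_find? (by fun_prop) (by fun_prop)) hS (by fun_prop)

theorem process {L : γ → List Code × Just} (hS : PolyTime S) (hL : PolyTime L) :
    PolyTime fun c => process (S c) (L c) := by
  have hscan := scan hS hL.fst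
  have hderive := derive hS (const .ax) hL.fst
    (hL.fst.list_map (f := fun _ a => (a, none)) (by fun_prop))
  refine of_ite hL.snd ((hscan.comp (val id)).congr fun c => ?_)
    ((hderive.comp (val id)).congr fun c => ?_)
  · have hc := mt enc_just_eq_nil.2 c.2
    unfold OrdRes.process
    split
    · contradiction
    · rfl
  · unfold OrdRes.process
    rw [enc_just_eq_nil.1 c.2]

end PolyTime

/-- The order, in the format of `encPerm`. -/
def positions (π : Equiv.Perm (Fin n)) : List ℕ := List.ofFn fun i => (π i : ℕ)

/-- The clause, in the format of `encClause`. -/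
def codes (C : Clause n) : List Code := List.ofFn (code C)

theorem length_positions : (positions π).length = n := List.length_ofFn

theorem enc_positions : enc (positions π) = encPerm π :=
  congrArg encList List.map_ofFn

theorem enc_codes (C : Clause n) : enc (codes C) = encClause C := by
  refine congrArg encList (List.map_ofFn.trans (congrArg List.ofFn (funext fun i => ?_)))
  simp only [Function.comp_apply, code]
  split_ifs <;> rfl

theorem enc_codes_just (P : Proof n) :
    enc (P.map fun L => (codes L.clause, L.just)) = encProof P := by
  refine congrArg encList (List.map_map.trans (List.map_congr_left fun L _ => ?_))
  exact congrArg (Data.cons · _) (enc_codes L.clause)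

theorem length_eq_of_encProof_eq {P Q : Proof n} (h : encProof P = encProof Q) :
    P.length = Q.length := by
  induction P generalizing Q with
  | nil => cases Q with
    | nil => rfl
    | cons M Q => cases h
  | cons L P ih => cases Q with
    | nil => cases h
    | cons M Q => exact congrArg Nat.succ (ih (Data.cons.inj h).2)

/-- Rearrange the entries of `c` in the order `p` of the variables, the largest variable first. -/
def sortCodes (p : List ℕ) (c : List Code) : List Code :=
  p.tails.tail.map fun t => ((p.zip c).find? fun x => x.1 == t.length).elim none Prod.snd

/-- The inverse of `sortCodes`. -/
def unsortCodes (p : List ℕ) (u : List Code) : List Code :=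
  p.map fun k => (u.reverse.drop k).head?.join

theorem tails_map_length {α : Type*} (l : List α) :
    l.tails.map List.length = (List.range (l.length + 1)).reverse := by
  induction l with
  | nil => rfl
  | cons a l ih => rw [List.tails_cons, List.map_cons, ih, List.length_cons,
      List.range_succ (n := l.length + 1), List.reverse_concat]

theorem find?_zip_positions_codes (C : Clause n) (i : Fin n) :
    ((positions π).zip (codes C)).find? (fun x => x.1 == (π i : ℕ)) =
      some ((π i : ℕ), code C i) := by
  have hzip : (positions π).zip (codes C) = List.ofFn fun i => ((π i : ℕ), code C i) := by
    refine List.ext_getElem ?_ fun k _ _ => ?_ <;> simp [positions, codes]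
  have hi : (((π i : ℕ), code C i) : ℕ × Code) ∈ (positions π).zip (codes C) :=
    hzip ▸ List.mem_ofFn.2 ⟨i, rfl⟩
  obtain ⟨x, hx⟩ := Option.isSome_iff_exists.1
    (List.find?_isSome (p := fun x : ℕ × Code => x.1 == (π i : ℕ)).2 ⟨_, hi, beq_self_eq_true _⟩)
  obtain ⟨j, rfl⟩ := List.mem_ofFn.1 (hzip ▸ List.mem_of_find?_eq_some hx)
  have hj := List.find?_some hx
  obtain rfl : j = i := by simpa [Fin.val_inj] using hj
  exact hx

theorem sortCodes_eq (C : Clause n) :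
    sortCodes (positions π) (codes C) = sortedCodes π C := by
  have hrange : (positions π).tails.tail.map List.length = (List.range n).reverse := by
    rw [List.map_tail, tails_map_length, length_positions, List.range_succ, List.reverse_concat,
      List.tail_cons]
  have hofFn : List.ofFn (fun k => code C (π.symm k)) = (List.range n).map fun k =>
      (((positions π).zip (codes C)).find? fun x => x.1 == k).elim none Prod.snd := by
    refine List.ext_getElem (by simp) fun k hk _ => ?_
    have := find?_zip_positions_codes (π := π) C (π.symm ⟨k, by simpa using hk⟩)
    simp_all
  rw [sortedCodes, hofFn, ← List.map_reverse, ← hrange, List.map_map]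
  rfl

theorem unsortCodes_eq (u : List Code) :
    unsortCodes (positions π) u = codes (clauseOf π u) := by
  refine List.map_ofFn.trans (congrArg List.ofFn (funext fun i => Option.ext fun b => ?_))
  simp [code_eq_some_iff, clauseOf, Option.join_eq_some_iff]

/-- An input of the simulation, encoded by `encInput`. -/
instance : Enc (Σ n, Equiv.Perm (Fin n) × Proof n) := ⟨fun x => encInput x.2.1 x.2.2⟩

namespace PolyTime

variable {γ : Type} [Enc γ]

@[fun_prop]
theorem sortCodes {p : γ → List ℕ} {c : γ → List Code} (hp : PolyTime p) (hc : PolyTime c) :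
    PolyTime fun a => sortCodes (p a) (c a) := by
  unfold OrdRes.sortCodes
  exact list_map (by fun_prop) (elim (list_find? (by fun_prop) (by fun_prop)) (by fun_prop)
    (by fun_prop))

@[fun_prop]
theorem unsortCodes {p : γ → List ℕ} {u : γ → List Code} (hp : PolyTime p) (hu : PolyTime u) :
    PolyTime fun a => unsortCodes (p a) (u a) := by
  unfold OrdRes.unsortCodes
  fun_prop

@[fun_prop]
theorem positions {f : γ → Σ n, Equiv.Perm (Fin n) × Proof n} (hf : PolyTime f) :
    PolyTime fun c => positions (f c).2.1 :=
  of_head hf fun _ => enc_positions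

theorem map_sortedLine {f : γ → Σ n, Equiv.Perm (Fin n) × Proof n} (hf : PolyTime f) :
    PolyTime fun c => (f c).2.2.map (sortedLine (f c).2.1) := by
  have hcodes : PolyTime fun c => (f c).2.2.map fun L => (codes L.clause, L.just) :=
    of_tail hf fun _ => enc_codes_just _
  refine (list_map (f := fun c L => (OrdRes.sortCodes (OrdRes.positions (f c).2.1) L.1, L.2))
    hcodes (by fun_prop)).congr fun c => ?_
  simp only [List.map_map, Function.comp_def, sortCodes_eq]
  rfl

theorem encProof_toProof {f : γ → Σ n, Equiv.Perm (Fin n) × Proof n} {S : γ → List Entry}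
    (hf : PolyTime f) (hS : PolyTime S) : PolyTime fun c => encProof (toProof (f c).2.1 (S c)) := by
  refine of_enc_eq (list_map (f := fun c E =>
    (OrdRes.unsortCodes (OrdRes.positions (f c).2.1) E.clause, E.just)) hS.list_reverse
    (by fun_prop)) fun c => ?_
  change encProof _ = _
  simp only [← enc_codes_just, toProof, List.map_reverse, List.map_map, unsortCodes_eq]
  rfl

end PolyTime

theorem IsProof.of_prefix {R : System} {P Q : Proof n} (h : IsProof R π τ Q) (hP : P <+: Q) :
    IsProof R π τ P := by
  obtain ⟨P', rfl⟩ := hP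
  intro t L hL
  have ht := (List.getElem?_eq_some_iff.1 hL).1
  exact (lineOK_append_iff ht.le).1 (h t L (List.getElem?_append_left ht ▸ hL))

theorem Valid.encSize_le {S : List Entry} (h : Valid π τ S) :
    encSize S ≤ S.length * (6 * S.length + 6 * n + 8) + 1 := by
  refine encSize_list_le fun E hE => ?_
  have hindex := (List.getElem?_eq_some_iff.1 (h.getElem?_index E hE)).1
  rw [length_toProof] at hindex
  have hclause := encSize_codes_le E.clause
  have hlen := h.length_le E hE
  have hjust : encSize E.just ≤ 4 * S.length + 3 := by
    have hok : LineOK ordered π τ _ _ _ := h.isProof _ _ (h.getElem?_index E hE)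
    unfold LineOK at hok
    change encSize (toLine π E).just ≤ _
    split at hok
    · rename_i hax
      rw [hax]
      change 1 ≤ _
      omega
    · rename_i j k hres
      rw [hres, encSize_just_res, encSize_nat, encSize_nat]
      omega
  rw [encSize_entry, encSize_nat]
  omega

theorem add_length_le_size_encInput (π : Equiv.Perm (Fin n)) (Γ : Proof n) :
    n + Γ.length ≤ (encInput π Γ).size := by
  have hn := length_le_encSize (positions π)
  have hΓ := length_le_encSize (Γ.map fun L => (codes L.clause, L.just))
  rw [encSize, enc_positions, length_positions] at hn
  rw [encSize, enc_codes_just, List.length_map] at hΓ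
  exact (Nat.add_le_add hn hΓ).trans (Nat.le_succ _)

theorem exists_prog_simulate : ∃ (p : Prog) (T : Polynomial ℕ), ∀ (n : ℕ)
    (π : Equiv.Perm (Fin n)) (τ : Set (Clause n)) (Γ : Proof n), IsProof halfOrdered π τ Γ →
      RunLE p (encInput π Γ) (encProof (toProof π (simulate (Γ.map (sortedLine π)))))
        (T.eval (encInput π Γ).size) := by
  let Input := {x : Σ n, Equiv.Perm (Fin n) × Proof n // ∃ τ, IsProof halfOrdered x.2.1 τ x.2.2}
  suffices hsim : PolyTime fun x : Input => simulate (x.1.2.2.map (sortedLine x.1.2.1)) by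
    obtain ⟨p, T, ⟨T', hT⟩, hp⟩ := PolyTime.encProof_toProof (.val .id) hsim
    exact ⟨p, T', fun n π τ Γ hΓ => (hp ⟨⟨n, π, Γ⟩, τ, hΓ⟩).mono (hT _)⟩
  let s : Input → ℕ := encSize
  let m : Input → ℕ := fun x => s x * (s x + 1)
  have hs : PolyBound s := .size
  have hm : PolyBound m := hs.mul (hs.add (.const 1))
  refine .foldl (.map_sortedLine (.val .id)) (.const []) (.process (by fun_prop) (by fun_prop))
    (B := fun x => m x * (6 * m x + 6 * s x + 8) + 1)
    ((hm.mul ((((PolyBound.const 6).mul hm).add ((PolyBound.const 6).mul hs)).add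
      (.const 8))).add (.const 1)) ?_
  rintro ⟨⟨n, π, Γ⟩, τ, hΓ⟩ l hl
  obtain ⟨Γ', hΓ', rfl⟩ := List.prefix_map_iff.1 hl
  have hsize : n + Γ.length ≤ s ⟨⟨n, π, Γ⟩, τ, hΓ⟩ := add_length_le_size_encInput π Γ
  have hlen : Γ'.length ≤ Γ.length := hΓ'.length_le
  have h := simulates_simulate (hΓ.of_prefix hΓ')
  have hS : (simulate (Γ'.map (sortedLine π))).length ≤ m ⟨⟨n, π, Γ⟩, τ, hΓ⟩ :=
    h.length_le_sq.trans (Nat.mul_le_mul (by omega) (by omega))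
  refine h.valid.encSize_le.trans ?_
  gcongr
  exact (Nat.le_add_right _ _).trans hsize

theorem pSimulates_of_le {R S : System} (h : ∀ n, ∀ π : Equiv.Perm (Fin n), R n π ≤ S n π) :
    PSimulates S R := by
  refine ⟨.tail, .X, .X, fun n π τ Γ hΓ =>
    ⟨Γ, _, .tail _, by simp, ⟨fun t L hL => ?_, hΓ.2⟩, by simp⟩⟩
  have hok := hΓ.1 t L hL
  unfold LineOK at hok ⊢
  split at hok
  · exact hok
  · obtain ⟨hj, hk, A, B, hA, hB, i, a, hAi, hBi, hR, hL⟩ := hok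
    exact ⟨hj, hk, A, B, hA, hB, i, a, hAi, hBi, h n π i _ _ hR, hL⟩

theorem ordered_le_halfOrdered (π : Equiv.Perm (Fin n)) : ordered n π ≤ halfOrdered n π :=
  fun _ _ _ h => .inl fun l hl => h l (Finset.mem_union_left _ hl)

end OrdRes

theorem theorem2p1 :
    OrdRes.PolyEquivalent OrdRes.ordered OrdRes.halfOrdered ∧
    ∃ p : OrdRes.Prog, OrdRes.IsPSimulation OrdRes.ordered OrdRes.halfOrdered p ∧
      ∀ (n : ℕ), 1 ≤ n → ∀ (π : Equiv.Perm (Fin n)) (τ : Set (OrdRes.Clause n))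
        (Γ Δ : OrdRes.Proof n) (t : ℕ), OrdRes.Refutes OrdRes.halfOrdered π τ Γ →
          OrdRes.Run p (OrdRes.encInput π Γ) (OrdRes.encProof Δ) t →
          Δ.length ≤ n * Γ.length := by
  obtain ⟨p, T, hp⟩ := OrdRes.exists_prog_simulate
  have hsim : OrdRes.IsPSimulation OrdRes.ordered OrdRes.halfOrdered p := by
    refine ⟨T, .X * (.X + 1), fun n π τ Γ hΓ => ?_⟩
    obtain ⟨t, ht, hrun⟩ := hp n π τ Γ hΓ.1
    have h := OrdRes.simulates_simulate hΓ.1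
    exact ⟨_, t, hrun, ht, h.refutes hΓ.2, by simpa [OrdRes.length_toProof] using h.length_le_sq⟩
  refine ⟨⟨⟨p, hsim⟩, OrdRes.pSimulates_of_le fun _ => OrdRes.ordered_le_halfOrdered⟩, p, hsim,
    fun n hn π τ Γ Δ t hΓ hrun => ?_⟩
  obtain ⟨_, -, hrun'⟩ := hp n π τ Γ hΓ.1
  rw [OrdRes.length_eq_of_encProof_eq (hrun.deterministic hrun'), OrdRes.length_toProof]
  exact (OrdRes.simulates_simulate hΓ.1).length_le_mul hn
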